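/- All Lie algebras are over $\mathbb{C}$ and finite-dimensional. For $f\in\mathfrak{g}^*$ let $B_f(x,y)=f([x,y])$; the index of $\mathfrak{g}$ is $\operatorname{ind}\mathfrak{g}=\min_{f\in\mathfrak{g}^*}\dim\ker B_f$, and $f$ is \emph{regular} if $\dim\ker B_f=\operatorname{ind}\mathfrak{g}$. Let $(a_1,\dots,a_m)$ and $(b_1,\dots,b_t)$ be compositions of $n$, and let $\mathfrak{g}\subseteq\mathfrak{gl}(n)$ be the seaweed of type $\frac{a_1|\cdots|a_m}{b_1|\cdots|b_t}$, i.e. the algebra of matrices preserving all $V_i=\operatorname{span}\{e_1,\dots,e_{a_1+\cdots+a_i}\}$ and all $W_j=\operatorname{span}\{e_{b_1+\cdots+b_j+1},\dots,e_n\}$. Its meander has vertices $v_1,\dots,v_n$ in a row, divided into consecutive top blocks of sizes $a_i$ and bottom blocks of sizes $b_j$; in each block of either row an edge joins the $k$-th vertex to the $k$-th vertex from the end, if these are different. \emph{Signature.} A meander is reduced to the empty one by the following moves, exactly one of which applies at each stage: $Bl$ (if $a_1=2b_1$): pass to $\frac{b_1|a_2|\cdots|a_m}{b_2|\cdots|b_t}$;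 $R$ (if $b_1<a_1<2b_1$): pass to $\frac{b_1|a_2|\cdots|a_m}{(2b_1-a_1)|b_2|\cdots|b_t}$; $P$ (if $a_1>2b_1$): pass to $\frac{(a_1-2b_1)|b_1|a_2|\cdots|a_m}{b_2|\cdots|b_t}$; $F$ (if $a_1<b_1$): exchange the two rows; $C(c)$ (if $a_1=b_1=c$): delete $a_1$ and $b_1$. The resulting sequence of moves is the signature; if $C(c_1),\dots,C(c_h)$ are the deletions in it, in order, then $\mathfrak{g}$ has homotopy type $H(c_1,\dots,c_h)$. The \emph{component meander} $CM(\mathfrak{g})$ is the meander whose signature is that of $\mathfrak{g}$ with every $C(c_i)$ replaced by $C(1)$. Its connected components are $h$ paths, and the path of $c_i$ is the one created by the $i$-th deletion move when the moves are reversed. Each vertex on the path of $c_i$ stands for $c_i$ adjacent vertices of the meander of $\mathfrak{g}$: if $c(v)$ denotes the size of the component of a vertex $v$, then the vertices of $CM(\mathfrak{g})$, from left to right, are $v_{A_1},v_{A_2},\dots$, where $A_1,A_2,\dots$ are consecutive intervals partitioning $\{1,\dots,n\}$ with $|A_j|=c(v_{A_j})$. Let $V_{c_i}$ be the set of all $A_j$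 with $v_{A_j}$ on the path of $c_i$. Orient top edges of $CM(\mathfrak{g})$ from right to left and bottom edges from left to right, and let $\mathfrak{P}_{c_i}$ be the set of blocks $A_I\times A_J$ with $A_I,A_J\in V_{c_i}$ and an oriented edge from $v_{A_I}$ to $v_{A_J}$. \emph{Functionals.} Let $F_{c_i}\in\mathfrak{gl}(c_i)^*$ be arbitrary, $i=1,\dots,h$. For $G=\sum g_{p,q}e_{p,q}^*\in\mathfrak{gl}(c)^*$ put $G^{k}=\sum g_{p,q}e_{p+k,q+k}^*$ and $G^{R}=\sum g_{p,q}e_{c+1-p,c+1-q}^*$. For each $i$ fix a vertex on the path of $c_i$, and let $\mathscr{A}_{c_i}$ (respectively $\mathscr{B}_{c_i}$) be the set of $A\in V_{c_i}$ such that the path from this vertex to $v_A$ has odd (respectively even) length. Let $\mathscr{D}_{c_i}$ and $\mathscr{D}^a_{c_i}$ be the sets of positions on the main diagonals and on the antidiagonals, respectively, of the $c_i\times c_i$ blocks in $\mathfrak{P}_{c_i}$. Define functionals on $\mathfrak{g}$ by $$\overline{F}=\sum_{i=1}^h\Bigl(\sum_{A\in V_{c_i}}(F_{c_i})^{\min A-1}+\sum_{(p,q)\in\mathscr{D}_{c_i}}e_{p,q}^*\Bigr),$$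 $$\overline{F}^a=\sum_{i=1}^h\Bigl(\sum_{A\in\mathscr{A}_{c_i}}(F_{c_i}^R)^{\min A-1}+\sum_{A\in\mathscr{B}_{c_i}}(F_{c_i})^{\min A-1}+\sum_{(p,q)\in\mathscr{D}^a_{c_i}}e_{p,q}^*\Bigr).$$ \textbf{Theorem.} $\overline{F}$ is regular on $\mathfrak{g}$ if and only if $F_{c_i}$ is regular on $\mathfrak{gl}(c_i)$ for every $i=1,\dots,h$. Likewise, $\overline{F}^a$ is regular on $\mathfrak{g}$ if and only if $F_{c_i}$ is regular on $\mathfrak{gl}(c_i)$ for every $i=1,\dots,h$. -/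

import Mathlib

attribute [local instance 100] LieRing.ofAssociativeRing

namespace Seaweed

/-! ## Index and regular functionals

All Lie algebras to which these notions are applied are finite-dimensional over `ℂ`. -/

section Index

variable {L : Type*} [LieRing L] [LieAlgebra ℂ L]

/-- The Kirillov form `B_f (x, y) = f [x, y]`, as a bilinear map. -/
def kirillovForm (f : Module.Dual ℂ L) : L →ₗ[ℂ] L →ₗ[ℂ] ℂ :=
  LinearMap.mk₂ ℂ (fun x y => f ⁅x, y⁆)
    (by intros; simp) (by intros; simp) (by intros; simp) (by intros; simp)

/-- `dim ker B_f`. -/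
noncomputable def kernelDim (f : Module.Dual ℂ L) : ℕ :=
  Module.finrank ℂ (LinearMap.ker (kirillovForm f))

variable (L) in
/-- The index of a Lie algebra: the minimum of `dim ker B_f` over all functionals `f`. -/
noncomputable def lieIndex : ℕ := ⨅ f : Module.Dual ℂ L, kernelDim f

/-- A functional is regular if it realizes the index. -/
def IsRegular (f : Module.Dual ℂ L) : Prop := kernelDim f = lieIndex L

end Index

/-- The Lie algebra `𝔤𝔩(n)` over `ℂ`, with the commutator bracket. -/
abbrev gl (n : ℕ) : Type := Matrix (Fin n) (Fin n) ℂ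

/-! ## Seaweed subalgebras of `𝔤𝔩(n)` -/

section Algebra

variable {n : ℕ}

/-- `V_i = span {e_1, …, e_{a_1 + ⋯ + a_i}}`. -/
def flagV (a : Composition n) (i : ℕ) : Submodule ℂ (Fin n → ℂ) :=
  Submodule.span ℂ {v | ∃ k : Fin n, (k : ℕ) < a.sizeUpTo i ∧ v = Pi.single k 1}

/-- `W_j = span {e_{b_1 + ⋯ + b_j + 1}, …, e_n}`. -/
def flagW (b : Composition n) (j : ℕ) : Submodule ℂ (Fin n → ℂ) :=
  Submodule.span ℂ {v | ∃ k : Fin n, b.sizeUpTo j ≤ (k : ℕ) ∧ v = Pi.single k 1}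

/-- The standard seaweed of type `(a_1 | ⋯ | a_m) / (b_1 | ⋯ | b_t)`: the matrices that preserve
every `V_i` and every `W_j`. -/
def seaweed (a b : Composition n) : LieSubalgebra ℂ (gl n) where
  carrier := {X | (∀ i ≤ a.length, ∀ v ∈ flagV a i, X.mulVec v ∈ flagV a i) ∧
    (∀ j ≤ b.length, ∀ v ∈ flagW b j, X.mulVec v ∈ flagW b j)}
  add_mem' := by
    rintro X Y ⟨hX, hX'⟩ ⟨hY, hY'⟩
    refine ⟨fun i hi v hv => ?_, fun i hi v hv => ?_⟩
    · rw [Matrix.add_mulVec]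
      exact add_mem (hX i hi v hv) (hY i hi v hv)
    · rw [Matrix.add_mulVec]
      exact add_mem (hX' i hi v hv) (hY' i hi v hv)
  zero_mem' := by
    refine ⟨fun i hi v hv => ?_, fun i hi v hv => ?_⟩ <;> simp
  smul_mem' := by
    rintro c X ⟨hX, hX'⟩
    refine ⟨fun i hi v hv => ?_, fun i hi v hv => ?_⟩
    · rw [Matrix.smul_mulVec]
      exact Submodule.smul_mem _ c (hX i hi v hv)
    · rw [Matrix.smul_mulVec]
      exact Submodule.smul_mem _ c (hX' i hi v hv)
  lie_mem' := by
    rintro X Y ⟨hX, hX'⟩ ⟨hY, hY'⟩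
    refine ⟨fun i hi v hv => ?_, fun i hi v hv => ?_⟩
    · rw [Ring.lie_def, Matrix.sub_mulVec, ← Matrix.mulVec_mulVec, ← Matrix.mulVec_mulVec]
      exact sub_mem (hX i hi _ (hY i hi v hv)) (hY i hi _ (hX i hi v hv))
    · rw [Ring.lie_def, Matrix.sub_mulVec, ← Matrix.mulVec_mulVec, ← Matrix.mulVec_mulVec]
      exact sub_mem (hX' i hi _ (hY' i hi v hv)) (hY' i hi _ (hX' i hi v hv))

end Algebra

/-! ## Winding meanders down and up -/

/-- The winding-down moves `Bl`, `R`, `P`, `F` and `C(c)`. -/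
inductive Move : Type
  | blockElimination
  | rotationContraction
  | pureContraction
  | flip
  | componentDeletion (c : ℕ)

/-- The signature of the meander of type `(a_1 | ⋯ | a_m) / (b_1 | ⋯ | b_t)`: the sequence of
winding-down moves that leads to the empty meander. The case `b = 0` does not occur for
compositions, whose parts are positive. -/
def signature : List ℕ → List ℕ → List Move
  | a :: as, b :: bs =>
    if a = b then Move.componentDeletion a :: signature as bs
    else if a < b then Move.flip :: signature (b :: bs) (a :: as)
    else if b = 0 then []
    else if a = 2 * b then Move.blockElimination :: signature (b :: as) bs
    else if a < 2 * b then Move.rotationContraction :: signature (b :: as) ((2 * b - a) :: bs)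
    else Move.pureContraction :: signature ((a - 2 * b) :: b :: as) bs
  | _, _ => []
termination_by as bs => (as.sum + bs.sum + (as.length + bs.length), bs.headD 0 - as.headD 0)
decreasing_by
  all_goals
    simp only [List.sum_cons, List.length_cons, List.headD_cons, Prod.lex_def]
    omega

/-- The sizes `c_1, …, c_h` of the component deletions in a list of moves, in order. -/
def deletionSizes : List Move → List ℕ
  | [] => []
  | Move.componentDeletion c :: S => c :: deletionSizes S
  | _ :: S => deletionSizes S

/-- A meander given by the sizes of its top blocks and of its bottom blocks, together with a list
that records, for each vertex from left to right, the index of the component it belongs to. -/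
structure LabelledMeander : Type where
  top : List ℕ
  bottom : List ℕ
  label : List ℕ

/-- Winding up: the meander with a given signature. The components are numbered `0, 1, …` in the
order in which their deletions occur in the signature. Reversing `C(c)` puts a new component on
`c` vertices to the left of the meander. Reversing `Bl`, `R` or `P` puts new vertices to the left
of the meander; each of them is the left end of a new top edge, and it gets the label of the right
end of that edge. (The cases `M => M` do not occur for signatures of meanders.) -/
def windUp : List Move → LabelledMeander
  | [] => ⟨[], [], []⟩
  | Move.componentDeletion c :: S =>
    let M := windUp S
    ⟨c :: M.top, c :: M.bottom, List.replicate c 0 ++ M.label.map (· + 1)⟩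
  | Move.flip :: S =>
    let M := windUp S
    ⟨M.bottom, M.top, M.label⟩
  | Move.blockElimination :: S =>
    match windUp S with
    | ⟨a :: as, bs, l⟩ => ⟨2 * a :: as, a :: bs, (l.take a).reverse ++ l⟩
    | M => M
  | Move.rotationContraction :: S =>
    match windUp S with
    | ⟨a :: as, b :: bs, l⟩ => ⟨(2 * a - b) :: as, a :: bs, (l.take a).reverse.take (a - b) ++ l⟩
    | M => M
  | Move.pureContraction :: S =>
    match windUp S with
    | ⟨a :: b :: as, bs, l⟩ => ⟨(a + 2 * b) :: as, b :: bs, ((l.drop a).take b).reverse ++ l⟩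
    | M => M

/-- `x` and `y` are the left and the right end of an edge in the row of blocks with the given
sizes: they are different vertices of one block, at equal distance from its ends. Vertices are
numbered from `0`. -/
def IsArc (blocks : List ℕ) (x y : ℕ) : Prop :=
  x < y ∧ ∃ (l₁ l₂ : List ℕ) (m : ℕ), blocks = l₁ ++ m :: l₂ ∧
    l₁.sum ≤ x ∧ y < l₁.sum + m ∧ x + y + 1 = 2 * l₁.sum + m

/-- The move with `C(c)` replaced by `C(1)`. -/
def Move.toUnit : Move → Move
  | Move.componentDeletion _ => Move.componentDeletion 1
  | m => m

section Core

variable {n : ℕ} (a b : Composition n)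

/-- The list `(c_1, …, c_h)` for which the seaweed has homotopy type `H(c_1, …, c_h)`. -/
def homotopyType : List ℕ := deletionSizes (signature a.blocks b.blocks)

/-- The component meander: it has the signature of the seaweed, except that all component
deletions are of size one. -/
def componentMeander : LabelledMeander :=
  windUp ((signature a.blocks b.blocks).map Move.toUnit)

/-- The vertices of the component meander. -/
abbrev CMVertex : Type := Fin (componentMeander a b).label.length

/-- The index of the component on whose path a vertex of the component meander lies. -/
def componentOf (v : CMVertex a b) : ℕ := (componentMeander a b).label.get v

/-- The number of vertices of the meander that are merged into the vertex `v = v_A` of the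
component meander, namely the size `c_i` of its component. -/
def size (v : CMVertex a b) : ℕ := (homotopyType a b).getD (componentOf a b v) 0

/-- The index set `A` of the vertex `v = v_A` of the component meander is an interval; in terms of
indices `0, …, n - 1` it is `{offset v, …, offset v + size v - 1}`. With indices `1, …, n`,
`offset v` is `min A - 1`. -/
def offset (v : CMVertex a b) : ℕ := ∑ u ∈ Finset.univ.filter (· < v), size a b u

/-- The edges of the component meander, oriented counter-clockwise: top edges from right to left,
bottom edges from left to right. -/
def OrientedEdge (u v : CMVertex a b) : Prop :=
  IsArc (componentMeander a b).top v u ∨ IsArc (componentMeander a b).bottom u v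

/-- The component meander as an undirected graph. -/
def cmGraph : SimpleGraph (CMVertex a b) := SimpleGraph.fromRel (OrientedEdge a b)

/-- The path from `u` to `v` in the component meander has odd length. -/
def OddPath (u v : CMVertex a b) : Prop :=
  ∃ p : (cmGraph a b).Walk u v, p.IsPath ∧ Odd p.length

open Classical in
/-- The vertices on the path of the component `c_i`. -/
noncomputable def pathVertices (i : ℕ) : Finset (CMVertex a b) :=
  Finset.univ.filter fun v => componentOf a b v = i

open Classical in
/-- The pairs `(I, J)` for which `A_I × A_J` is in the peak set of the component `c_i`. -/
noncomputable def peakSet (i : ℕ) : Finset (CMVertex a b × CMVertex a b) :=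
  (pathVertices a b i ×ˢ pathVertices a b i).filter fun P => OrientedEdge a b P.1 P.2

end Core

/-! ## The functionals -/

/-- The functional `e_{i,j}^*` on `n × n` matrices, with indices from `0`. (It is `0` for indices
out of range.) -/
noncomputable def entryDual (n i j : ℕ) : Module.Dual ℂ (gl n) :=
  if h : i < n ∧ j < n then Matrix.entryLinearMap ℂ ℂ ⟨i, h.1⟩ ⟨j, h.2⟩ else 0

/-- The coefficient of `e_{p,q}^*` in `F`. -/
noncomputable def coeff {c : ℕ} (F : Module.Dual ℂ (gl c)) (p q : Fin c) : ℂ :=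
  F (Matrix.single p q 1)

/-- The shift `F^k` of a functional on `𝔤𝔩(c)`: each `e_{p,q}^*` becomes `e_{p+k,q+k}^*`. -/
noncomputable def shift {c : ℕ} (F : Module.Dual ℂ (gl c)) (n k : ℕ) : Module.Dual ℂ (gl n) :=
  ∑ p : Fin c, ∑ q : Fin c, coeff F p q • entryDual n (p + k) (q + k)

/-- The rotation `F^R` of a functional on `𝔤𝔩(c)`: each `e_{p,q}^*` becomes `e_{c+1-p,c+1-q}^*`
(indices from `1`). -/
noncomputable def rotate {c : ℕ} (F : Module.Dual ℂ (gl c)) : Module.Dual ℂ (gl c) :=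
  ∑ p : Fin c, ∑ q : Fin c, coeff F p q • entryDual c p.rev q.rev

section Functional

variable {n : ℕ} (a b : Composition n)

/-- A choice of functionals `F_{c_i} ∈ 𝔤𝔩(c_i)^*`, one for each component. -/
abbrev ComponentFunctionals : Type :=
  ∀ i : Fin (homotopyType a b).length, Module.Dual ℂ (gl ((homotopyType a b).get i))

variable {a b} (F : ComponentFunctionals a b)

/-- The summand of `F̄` for the component `c_i`: `F_{c_i}` on each core block, and the main diagonal
of each peak block. -/
noncomputable def barComponent (i : Fin (homotopyType a b).length) : Module.Dual ℂ (gl n) :=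
  ∑ v ∈ pathVertices a b i, shift (F i) n (offset a b v) +
  ∑ P ∈ peakSet a b i, ∑ s ∈ Finset.range ((homotopyType a b).get i),
    entryDual n (offset a b P.1 + s) (offset a b P.2 + s)

open Classical in
/-- The summand of `F̄^a` for the component `c_i`: `F_{c_i}` on the core blocks at even distance
from the vertex `base`, its rotation on the core blocks at odd distance, and the antidiagonal of
each peak block. -/
noncomputable def barAntiComponent (base : CMVertex a b) (i : Fin (homotopyType a b).length) :
    Module.Dual ℂ (gl n) :=
  ∑ v ∈ pathVertices a b i,
    (if OddPath a b base v then shift (rotate (F i)) n (offset a b v)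
      else shift (F i) n (offset a b v)) +
  ∑ P ∈ peakSet a b i, ∑ s ∈ Finset.range ((homotopyType a b).get i),
    entryDual n (offset a b P.1 + ((homotopyType a b).get i - 1 - s)) (offset a b P.2 + s)

/-- The functional `F̄` on the seaweed. -/
noncomputable def bar : Module.Dual ℂ (seaweed a b) :=
  (∑ i, barComponent F i).comp (seaweed a b).toSubmodule.subtype

/-- The functional `F̄^a` on the seaweed; `base i` is the vertex on the path of `c_i` from which
distances are measured. -/
noncomputable def barAnti (base : Fin (homotopyType a b).length → CMVertex a b) :
    Module.Dual ℂ (seaweed a b) :=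
  (∑ i, barAntiComponent F (base i) i).comp (seaweed a b).toSubmodule.subtype

end Functional

end Seaweed

/-!
The functionals `F̄` and `F̄^a` are restrictions to the seaweed of functionals `X ↦ tr (M X)`. The
radical of the form `tr (M [X, Y])` is computed by winding the component meander down.

*Coordinates.* The vertices of the component meander, each blown up to an interval of `c_i` indices
(`BlowUp`), index the rows and columns of the seaweed; the seaweed consists of the matrices
supported on a preorder (`Allowed`) that only depends on the vertices. In these coordinates `M` has
the coefficients of `F_{c_i}` on the diagonal blocks of the path of `c_i` and identity blocks at
the edges (`meanderMatrix`). For `F̄^a`, reversing the intervals at odd distance from the base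
vertices gives the same matrix, because every edge changes the parity of the distance
(`barAnti_eq`).

*Kernel dimension.* When the first bottom block is contracted, the part of the seaweed in its
columns and in the remaining rows is an abelian ideal. It meets the radical trivially, and its
orthogonal is the sum of the ideal and of the pull-back of the contracted seaweed along the map
that folds the block onto its neighbours (`Fold`). By `finrank_ker_eq_of_isotropic_reduction`, the
radical has the same dimension before and after the contraction (`Fold.radDim_eq`). Folding adds up
the diagonal coefficients of the vertices that are identified, which stay positive multiples of
those of `F_{c_i}`; therefore the statement that passes through the induction allows positive
weights (`CoreData.radDim_eq`). A deletion splits off the form of a multiple of `F_{c_i}` on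
`𝔤𝔩(c_i)`. So `dim ker B_{F̄} = ∑ i, dim ker B_{F_{c_i}}` for all choices of the `F_{c_i}`.

*Index.* It remains to see that `ind 𝔤 = ∑ i, ind 𝔤𝔩(c_i)`. One inequality follows by taking
regular `F_{c_i}`. For the other, let `f₀` be the functional with all `F_{c_i} = 0`. The kernel of
its form has dimension `∑ i, c_i ^ 2`, so it consists of the block diagonal matrices that are
constant along the paths. Since the trace form is nondegenerate on those, the functionals `F̄` for
all choices of `F_{c_i}` form a slice that is transversal to the coadjoint orbit of `f₀`. By the
open mapping theorem every functional near `f₀` is conjugate to one in the slice, so the lower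
bound `∑ i, ind 𝔤𝔩(c_i)`, valid on the slice, holds near `f₀`, and by semicontinuity everywhere
(`le_kernelDim_of_slice`).

Both equivalences follow, since a sum of numbers `dim ker B_{F_{c_i}} ≥ ind 𝔤𝔩(c_i)` attains the
sum of the lower bounds exactly when each of its terms does.
-/

set_option linter.unusedSectionVars false

namespace Seaweed

/-! ### Reduction of a skew form by an isotropic subspace -/

/-- Let `𝔞` be a subspace that meets the radical of the skew form `B` trivially and whose orthogonal
is `s(V') ⊕ 𝔞`. Then `𝔞` is isotropic, `𝔞ᗮ ⧸ 𝔞` is isometric to `V'` through `s`, and the radicals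
of the two forms have the same dimension. -/
theorem finrank_ker_eq_of_isotropic_reduction {V V' : Type*} [AddCommGroup V] [Module ℂ V]
    [FiniteDimensional ℂ V] [AddCommGroup V'] [Module ℂ V']
    (B : V →ₗ[ℂ] V →ₗ[ℂ] ℂ) (B' : V' →ₗ[ℂ] V' →ₗ[ℂ] ℂ) (hB : ∀ x y, B x y = -B y x)
    (s : V' →ₗ[ℂ] V) (𝔞 : Submodule ℂ V)
    (hperp : ∀ x, (∀ y ∈ 𝔞, B x y = 0) ↔ x ∈ LinearMap.range s ⊔ 𝔞)
    (hs : ∀ x, s x ∈ 𝔞 → x = 0) (hBs : ∀ x y, B (s x) (s y) = B' x y)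
    (hker : ∀ x ∈ 𝔞, (∀ y, B x y = 0) → x = 0) :
    Module.finrank ℂ (LinearMap.ker B) = Module.finrank ℂ (LinearMap.ker B') := by
  have hB0 : ∀ x y, B x y = 0 ↔ B y x = 0 := fun x y => by rw [hB, neg_eq_zero]
  set N : Submodule ℂ V := LinearMap.range s ⊔ 𝔞 with hN
  have horthA : LinearMap.BilinForm.orthogonal B 𝔞 = N := by
    ext x
    rw [hN, ← hperp, LinearMap.BilinForm.mem_orthogonal_iff]
    exact forall₂_congr fun y _ => hB0 y x
  have h𝔞N : 𝔞 ≤ N := le_sup_right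
  have hmem : ∀ x, x ∈ N → ∀ y ∈ 𝔞, B x y = 0 := fun x hx => (hperp x).2 hx
  have hkerN : LinearMap.ker B ≤ N := fun x hx => by
    rw [hN, ← hperp]
    intro y _
    rw [LinearMap.mem_ker.1 hx, LinearMap.zero_apply]
  have hsN : ∀ x, s x ∈ N := fun x => Submodule.mem_sup_left ⟨x, rfl⟩
  have horthN : LinearMap.BilinForm.orthogonal B N = (LinearMap.ker B').map s ⊔ 𝔞 := by
    ext x
    rw [LinearMap.BilinForm.mem_orthogonal_iff]
    constructor
    · intro hx
      have hxN : x ∈ N := by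
        rw [hN, ← hperp]
        exact fun y hy => (hB0 _ _).1 (hx y (h𝔞N hy))
      obtain ⟨_, ⟨x', rfl⟩, z, hz, rfl⟩ := Submodule.mem_sup.1 hxN
      refine Submodule.add_mem_sup ⟨x', ?_, rfl⟩ hz
      refine LinearMap.mem_ker.2 (LinearMap.ext fun y => ?_)
      have h1 := (hB0 _ _).1 (hx (s y) (hsN y))
      rw [map_add, LinearMap.add_apply, hBs, (hB0 _ _).1 (hmem _ (hsN y) z hz), add_zero] at h1
      simpa using h1
    · intro hx y hy
      obtain ⟨_, ⟨x', hx', rfl⟩, z, hz, rfl⟩ := Submodule.mem_sup.1 hx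
      obtain ⟨_, ⟨y', rfl⟩, w, hw, rfl⟩ := Submodule.mem_sup.1 hy
      change B _ _ = 0
      rw [map_add (B _), hmem _ hy z hz, add_zero, hB0, map_add (B _), hmem _ (hsN x') w hw,
        add_zero, hBs, LinearMap.mem_ker.1 hx', LinearMap.zero_apply]
  have d1 := LinearMap.BilinForm.finrank_add_finrank_orthogonal' (B := B) 𝔞
  have d2 := LinearMap.BilinForm.finrank_add_finrank_orthogonal' (B := B) N
  have i1 : 𝔞 ⊓ LinearMap.ker B = ⊥ := by
    refine (Submodule.eq_bot_iff _).2 fun x hx => hker x hx.1 fun y => ?_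
    rw [LinearMap.mem_ker.1 hx.2, LinearMap.zero_apply]
  have i2 : N ⊓ LinearMap.ker B = LinearMap.ker B := inf_eq_right.2 hkerN
  have i3 : (LinearMap.ker B').map s ⊓ 𝔞 = ⊥ := by
    refine (Submodule.eq_bot_iff _).2 ?_
    rintro _ ⟨⟨x', _, rfl⟩, hx⟩
    rw [hs x' hx, map_zero]
  have hsinj : Function.Injective s := by
    refine (injective_iff_map_eq_zero s).2 fun x hx => hs x ?_
    rw [hx]
    exact zero_mem _
  have : FiniteDimensional ℂ V' := FiniteDimensional.of_injective s hsinj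
  have d3 := Submodule.finrank_sup_add_finrank_inf_eq ((LinearMap.ker B').map s) 𝔞
  rw [i3, finrank_bot,
    ← (Submodule.equivMapOfInjective s hsinj (LinearMap.ker B')).finrank_eq] at d3
  rw [horthA, i1, finrank_bot] at d1
  rw [horthN, i2] at d2
  omega

/-! ### Trace forms on spaces of matrices with prescribed support -/

section Support

variable {ι ι' : Type*}

/-- The matrices whose entries vanish outside the relation `P`. -/
def supported (P : ι → ι → Prop) : Submodule ℂ (Matrix ι ι ℂ) where
  carrier := {X | ∀ x y, ¬P x y → X x y = 0}
  add_mem' := fun hX hY x y h => by rw [Matrix.add_apply, hX x y h, hY x y h, add_zero]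
  zero_mem' := fun _ _ _ => rfl
  smul_mem' := fun c X hX x y h => by rw [Matrix.smul_apply, hX x y h, smul_zero]

theorem single_mem_supported [DecidableEq ι] {P : ι → ι → Prop} {x y : ι} (h : P x y) (c : ℂ) :
    Matrix.single x y c ∈ supported P := by
  intro u v huv
  refine Matrix.single_apply_of_ne _ _ _ _ _ ?_
  rintro ⟨rfl, rfl⟩
  exact huv h

variable [Fintype ι] [Fintype ι']

/-- The form `(X, Y) ↦ tr (M [X, Y])` on the matrices supported on `P`. -/
def traceForm (P : ι → ι → Prop) (M : Matrix ι ι ℂ) :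
    supported P →ₗ[ℂ] supported P →ₗ[ℂ] ℂ :=
  LinearMap.mk₂ ℂ (fun X Y => (M * (X.1 * Y.1 - Y.1 * X.1)).trace)
    (by intros; simp [Matrix.mul_add, Matrix.add_mul, Matrix.mul_sub]; ring)
    (by intros; simp [mul_sub])
    (by intros; simp [Matrix.mul_add, Matrix.add_mul, Matrix.mul_sub]; ring)
    (by intros; simp [mul_sub])

theorem traceForm_apply (P : ι → ι → Prop) (M : Matrix ι ι ℂ) (X Y : supported P) :
    traceForm P M X Y = (M * (X.1 * Y.1 - Y.1 * X.1)).trace := rfl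

/-- The left-hand argument lies in the radical if and only if `M X - X M` pairs to zero with the
whole space, that is, if its entries at the transposes of the positions in `P` vanish. -/
theorem traceForm_apply' (P : ι → ι → Prop) (M : Matrix ι ι ℂ) (X Y : supported P) :
    traceForm P M X Y = ((M * X.1 - X.1 * M) * Y.1).trace := by
  rw [traceForm_apply, Matrix.mul_sub, Matrix.sub_mul, Matrix.trace_sub, Matrix.trace_sub,
    ← Matrix.mul_assoc, ← Matrix.mul_assoc, Matrix.trace_mul_comm (M * Y.1), ← Matrix.mul_assoc]

theorem traceForm_swap (P : ι → ι → Prop) (M : Matrix ι ι ℂ) (X Y : supported P) :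
    traceForm P M X Y = -traceForm P M Y X := by
  rw [traceForm_apply, traceForm_apply, ← Matrix.trace_neg, ← Matrix.mul_neg, neg_sub]

theorem traceForm_single [DecidableEq ι] {P : ι → ι → Prop} (M : Matrix ι ι ℂ) (X : supported P)
    {x y : ι} (h : P y x) :
    traceForm P M X ⟨Matrix.single y x 1, single_mem_supported h 1⟩
      = (M * X.1) x y - (X.1 * M) x y := by
  rw [traceForm_apply', Matrix.trace_mul_single]
  simp

/-- The dimension of the radical of the form `(X, Y) ↦ tr (M [X, Y])` on the matrices supported
on `P`. -/
noncomputable def radDim (P : ι → ι → Prop) (M : Matrix ι ι ℂ) : ℕ :=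
  Module.finrank ℂ (LinearMap.ker (traceForm P M))

end Support

/-! ### Folding -/

/-- A folding map `ρ` between two index sets with relations `P` and `P'`, as it arises when the
first blocks of a seaweed are contracted. The index set is divided into a left part `L` (the first
bottom block) and its complement, of which `T` is the part inside the first top block. The map `ρ`
is injective on each of the two parts; when `ρ x = ρ y` with `x` on the left and `y` on the right,
`x` and `y` are joined by a contracted edge and are called partners. The two blocks `L × L` and
`Lᶜ × Lᶜ` of the larger support are compared with `P'`. The fields `right_forced` and `left_forced`
concern the positions in these blocks that do not come from `P'`: if `X` commutes with the partner
matrix on the block `L × (T \ L)`, then comparing entries forces `X` to vanish there. -/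
structure Fold {ι ι' : Type*} (P : ι → ι → Prop) (P' : ι' → ι' → Prop) (L T : ι → Prop)
    (ρ : ι → ι') : Prop where
  inj : ∀ x y, (L x ↔ L y) → ρ x = ρ y → x = y
  surj : ∀ p, ∃ x, ρ x = p
  left_left : ∀ x y, L x → L y → P x y
  left_right : ∀ x y, L x → ¬L y → ¬P x y
  right_left : ∀ x y, ¬L x → L y → (P x y ↔ T x)
  partner_T : ∀ x y, L x → ¬L y → ρ x = ρ y → T y
  pull : ∀ x y, (L x ↔ L y) → P' (ρ x) (ρ y) → P x y
  right_forced : ∀ x y, ¬L x → ¬L y → P x y → ¬P' (ρ x) (ρ y) →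
    T y ∧ (∃ x₀, L x₀ ∧ ρ x₀ = ρ x) ∧ ∀ y₀, L y₀ → ρ y₀ ≠ ρ y
  left_forced : ∀ x y, L x → L y → ¬P' (ρ x) (ρ y) →
    ∃ y₁, ¬L y₁ ∧ ρ y₁ = ρ y ∧ ∀ x₁, ¬L x₁ → ρ x₁ = ρ x → ¬P x₁ y₁
  cross : ∀ x y, L x → ¬L y → T y → P' (ρ x) (ρ y) →
    ((∃ x₁, ¬L x₁ ∧ ρ x₁ = ρ x) ↔ ∃ y₀, L y₀ ∧ ρ y₀ = ρ y)
  through : ∀ x y r, (L x ↔ L y) → P' (ρ x) r → P' r (ρ y) → ∃ z, (L z ↔ L x) ∧ ρ z = r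
  lift : ∀ p q, P' p q → ∃ x y, (L x ↔ L y) ∧ ρ x = p ∧ ρ y = q
  partner_or : ∀ x y, L x → ¬L y → T y →
    (∃ x₁, ¬L x₁ ∧ ρ x₁ = ρ x) ∨ ∃ y₀, L y₀ ∧ ρ y₀ = ρ y
  partner_P : ∀ x y y', L x → ¬L y → ¬L y' → ρ x = ρ y → T y' →
    (∀ x', L x' → ρ x' ≠ ρ y') → P y y'

namespace Fold

section Algebra

variable {ι ι' : Type*} [Fintype ι] [Fintype ι'] [DecidableEq ι] [DecidableEq ι']
variable {P : ι → ι → Prop} {P' : ι' → ι' → Prop} {L T : ι → Prop} {ρ : ι → ι'}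

open Classical in
/-- The matrix on the left and right diagonal blocks that is pulled back along a folding map. -/
noncomputable def pullback (L : ι → Prop) (ρ : ι → ι') :
    Matrix ι' ι' ℂ →ₗ[ℂ] Matrix ι ι ℂ where
  toFun X := Matrix.of fun x y => if (L x ↔ L y) then X (ρ x) (ρ y) else 0
  map_add' X Y := by
    ext x y
    by_cases h : L x ↔ L y <;> simp [h]
  map_smul' c X := by
    ext x y
    by_cases h : L x ↔ L y <;> simp [h]

theorem pullback_same (X : Matrix ι' ι' ℂ) {x y : ι} (h : L x ↔ L y) :
    pullback L ρ X x y = X (ρ x) (ρ y) := if_pos h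

theorem pullback_diff (X : Matrix ι' ι' ℂ) {x y : ι} (h : ¬(L x ↔ L y)) :
    pullback L ρ X x y = 0 := if_neg h

/-- The block of right rows and left columns, an abelian ideal. -/
def ideal (P : ι → ι → Prop) (L : ι → Prop) : Submodule ℂ (supported P) :=
  (supported fun x y => ¬L x ∧ L y).comap (supported P).subtype

theorem mem_ideal {X : supported P} :
    X ∈ ideal P L ↔ ∀ x y, ¬(¬L x ∧ L y) → X.1 x y = 0 := Iff.rfl

theorem pullback_mem (h : Fold P P' L T ρ) {X : Matrix ι' ι' ℂ} (hX : X ∈ supported P') :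
    pullback L ρ X ∈ supported P := by
  intro x y hxy
  by_cases hs : L x ↔ L y
  · rw [pullback_same X hs]
    exact hX _ _ fun hP => hxy (h.pull x y hs hP)
  · exact pullback_diff X hs

/-- On the block `L × Lᶜ` the matrix `M` is the partner relation, so that multiplication by `M` from
the left replaces a row by that of its partner. -/
theorem mul_apply_of_partner (h : Fold P P' L T ρ) {M X : Matrix ι ι ℂ}
    (hM : ∀ x y, L x → ¬L y → M x y = if ρ x = ρ y then 1 else 0) {x x₁ y : ι}
    (hX : ∀ u, L u → X u y = 0) (hx : L x) (hx₁ : ¬L x₁) (hp : ρ x₁ = ρ x) :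
    (M * X) x y = X x₁ y := by
  rw [Matrix.mul_apply, Finset.sum_eq_single x₁]
  · rw [hM x x₁ hx hx₁, if_pos hp.symm, one_mul]
  · intro u _ hu
    by_cases hLu : L u
    · rw [hX u hLu, mul_zero]
    · rw [hM x u hx hLu, if_neg, zero_mul]
      exact fun he => hu (h.inj u x₁ (by tauto) (by rw [hp, he]))
  · simp

theorem mul_apply_of_no_partner {M X : Matrix ι ι ℂ}
    (hM : ∀ x y, L x → ¬L y → M x y = if ρ x = ρ y then 1 else 0) {x y : ι}
    (hX : ∀ u, L u → X u y = 0) (hx : L x) (hp : ∀ x₁, ¬L x₁ → ρ x₁ ≠ ρ x) :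
    (M * X) x y = 0 := by
  rw [Matrix.mul_apply]
  refine Finset.sum_eq_zero fun u _ => ?_
  by_cases hLu : L u
  · rw [hX u hLu, mul_zero]
  · rw [hM x u hx hLu, if_neg fun he => hp u hLu he.symm, zero_mul]

/-- Multiplication by `M` from the right replaces a column by that of its partner. -/
theorem apply_mul_of_partner (h : Fold P P' L T ρ) {M X : Matrix ι ι ℂ}
    (hM : ∀ x y, L x → ¬L y → M x y = if ρ x = ρ y then 1 else 0) {x y y₀ : ι}
    (hX : ∀ u, ¬L u → X x u = 0) (hy : ¬L y) (hy₀ : L y₀) (hp : ρ y₀ = ρ y) :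
    (X * M) x y = X x y₀ := by
  rw [Matrix.mul_apply, Finset.sum_eq_single y₀]
  · rw [hM y₀ y hy₀ hy, if_pos hp, mul_one]
  · intro u _ hu
    by_cases hLu : L u
    · rw [hM u y hLu hy, if_neg, mul_zero]
      exact fun he => hu (h.inj u y₀ (by tauto) (by rw [hp, he]))
    · rw [hX u hLu, zero_mul]
  · simp

theorem apply_mul_of_no_partner {M X : Matrix ι ι ℂ}
    (hM : ∀ x y, L x → ¬L y → M x y = if ρ x = ρ y then 1 else 0) {x y : ι}
    (hX : ∀ u, ¬L u → X x u = 0) (hy : ¬L y) (hp : ∀ y₀, L y₀ → ρ y₀ ≠ ρ y) :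
    (X * M) x y = 0 := by
  rw [Matrix.mul_apply]
  refine Finset.sum_eq_zero fun u _ => ?_
  by_cases hLu : L u
  · rw [hM u y hLu hy, if_neg fun he => hp u hLu he, mul_zero]
  · rw [hX u hLu, zero_mul]

open Classical in
/-- Pulling back is adjoint, for the trace pairing, to summing the entries over the fibres. -/
theorem trace_mul_pullback {M : Matrix ι ι ℂ} {M' : Matrix ι' ι' ℂ}
    (hM' : ∀ p q, M' p q = ∑ x, ∑ y, if (L x ↔ L y) ∧ ρ x = p ∧ ρ y = q then M x y else 0)
    (Z : Matrix ι' ι' ℂ) : (M * pullback L ρ Z).trace = (M' * Z).trace := by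
  simp only [Matrix.trace, Matrix.diag_apply, Matrix.mul_apply, hM', Finset.sum_mul]
  have e : ∀ p : ι', ∑ q : ι', ∑ x : ι, ∑ y : ι,
      (if (L x ↔ L y) ∧ ρ x = p ∧ ρ y = q then M x y else 0) * Z q p =
      ∑ x : ι, ∑ y : ι, ∑ q : ι',
        (if (L x ↔ L y) ∧ ρ x = p ∧ ρ y = q then M x y else 0) * Z q p := by
    intro p
    rw [Finset.sum_comm]
    refine Finset.sum_congr rfl fun x _ => ?_
    rw [Finset.sum_comm]
  refine Eq.trans ?_ (Finset.sum_congr rfl fun p _ => (e p).symm)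
  conv_rhs => rw [Finset.sum_comm]
  refine Finset.sum_congr rfl fun x _ => ?_
  conv_rhs => rw [Finset.sum_comm]
  refine Finset.sum_congr rfl fun y _ => ?_
  by_cases hs : L x ↔ L y
  · rw [pullback_same Z hs.symm, Finset.sum_eq_single (ρ x), Finset.sum_eq_single (ρ y)]
    · simp [hs]
    · intro q _ hq
      rw [if_neg (fun hh => hq hh.2.2.symm), zero_mul]
    · simp
    · intro p _ hp
      refine Finset.sum_eq_zero fun q _ => ?_
      rw [if_neg (fun hh => hp hh.2.1.symm), zero_mul]
    · simp
  · rw [pullback_diff Z (by tauto), mul_zero]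
    symm
    refine Finset.sum_eq_zero fun p _ => Finset.sum_eq_zero fun q _ => ?_
    rw [if_neg (fun hh => hs hh.1), zero_mul]

theorem pullback_mul (h : Fold P P' L T ρ) {X Y : Matrix ι' ι' ℂ} (hX : X ∈ supported P')
    (hY : Y ∈ supported P') :
    pullback L ρ X * pullback L ρ Y = pullback L ρ (X * Y) := by
  classical
  ext x y
  by_cases hs : L x ↔ L y
  · rw [pullback_same _ hs, Matrix.mul_apply, Matrix.mul_apply,
      ← Finset.sum_filter_add_sum_filter_not Finset.univ (fun z => L z ↔ L x),
      Finset.sum_eq_zero (s := Finset.univ.filter fun z => ¬(L z ↔ L x)), add_zero]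
    · have h1 : ∀ z ∈ Finset.univ.filter (fun z => L z ↔ L x),
          pullback L ρ X x z * pullback L ρ Y z y = X (ρ x) (ρ z) * Y (ρ z) (ρ y) := by
        intro z hz
        have hz := (Finset.mem_filter.1 hz).2
        rw [pullback_same X hz.symm, pullback_same Y (hz.trans hs)]
      rw [Finset.sum_congr rfl h1,
        ← Finset.sum_image (g := ρ) (f := fun r => X (ρ x) r * Y r (ρ y))]
      · refine Finset.sum_subset (Finset.subset_univ _) fun r _ hr => ?_
        by_cases h2 : P' (ρ x) r
        · by_cases h3 : P' r (ρ y)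
          · obtain ⟨z, hz, rfl⟩ := h.through x y r hs h2 h3
            exact absurd (Finset.mem_image_of_mem ρ
              (Finset.mem_filter.2 ⟨Finset.mem_univ z, hz⟩)) hr
          · rw [hY _ _ h3, mul_zero]
        · rw [hX _ _ h2, zero_mul]
      · intro u hu v hv huv
        have hu := (Finset.mem_filter.1 hu).2
        have hv := (Finset.mem_filter.1 hv).2
        exact h.inj u v (hu.trans hv.symm) huv
    · intro z hz
      have hz := (Finset.mem_filter.1 hz).2
      rw [pullback_diff X (by tauto), zero_mul]
  · rw [pullback_diff _ hs, Matrix.mul_apply]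
    refine Finset.sum_eq_zero fun z _ => ?_
    by_cases hz : L x ↔ L z
    · rw [pullback_diff Y (by tauto), mul_zero]
    · rw [pullback_diff X hz, zero_mul]

/-- The pull-back along a folding map, as a map between matrices with prescribed supports. -/
noncomputable def pullbackSupported (h : Fold P P' L T ρ) : supported P' →ₗ[ℂ] supported P :=
  (pullback L ρ).restrict fun _ hX => h.pullback_mem hX

theorem pullbackSupported_coe (h : Fold P P' L T ρ) (X : supported P') :
    (h.pullbackSupported X).1 = pullback L ρ X.1 := rfl

theorem supported_left_right (h : Fold P P' L T ρ) (X : supported P) {x y : ι} (hx : L x)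
    (hy : ¬L y) : X.1 x y = 0 := X.2 _ _ (h.left_right x y hx hy)

open Classical in
/-- An element of the orthogonal of the ideal has equal entries at partner positions, and therefore
its diagonal blocks are pulled back from the folded index set. -/
theorem exists_pullback (h : Fold P P' L T ρ) {M : Matrix ι ι ℂ}
    (hM : ∀ x y, L x → ¬L y → M x y = if ρ x = ρ y then 1 else 0) (X : supported P)
    (hX : ∀ x y, L x → ¬L y → T y → (M * X.1) x y = (X.1 * M) x y) :
    ∃ X' : supported P', ∀ x y, (L x ↔ L y) → X'.1 (ρ x) (ρ y) = X.1 x y := by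
  have col : ∀ {y}, ¬L y → ∀ u, L u → X.1 u y = 0 :=
    fun hy u hu => h.supported_left_right X hu hy
  have row : ∀ {x}, L x → ∀ u, ¬L u → X.1 x u = 0 :=
    fun hx u hu => h.supported_left_right X hx hu
  have aux : ∀ x y x' y', L x → L y → ¬L x' → ¬L y' → ρ x = ρ x' → ρ y = ρ y' →
      X.1 x y = X.1 x' y' := by
    intro x y x' y' hx hy hx' hy' e1 e2
    have := hX x y' hx hy' (h.partner_T y y' hy hy' e2)
    rwa [h.mul_apply_of_partner hM (col hy') hx hx' e1.symm,
      h.apply_mul_of_partner hM (row hx) hy' hy e2, eq_comm] at this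
  have wd : ∀ x y x' y', (L x ↔ L y) → (L x' ↔ L y') → ρ x = ρ x' → ρ y = ρ y' →
      X.1 x y = X.1 x' y' := by
    intro x y x' y' hs hs' e1 e2
    by_cases hc : L x ↔ L x'
    · rw [h.inj x x' hc e1, h.inj y y' (by tauto) e2]
    · by_cases hx : L x
      · exact aux x y x' y' hx (by tauto) (by tauto) (by tauto) e1 e2
      · exact (aux x' y' x y (by tauto) (by tauto) hx (by tauto) e1.symm e2.symm).symm
  let X' : Matrix ι' ι' ℂ := fun p q =>
    if hz : ∃ z : ι × ι, (L z.1 ↔ L z.2) ∧ ρ z.1 = p ∧ ρ z.2 = q then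
      X.1 hz.choose.1 hz.choose.2 else 0
  have hX' : ∀ x y, (L x ↔ L y) → X' (ρ x) (ρ y) = X.1 x y := by
    intro x y hs
    have hz : ∃ z : ι × ι, (L z.1 ↔ L z.2) ∧ ρ z.1 = ρ x ∧ ρ z.2 = ρ y := ⟨(x, y), hs, rfl, rfl⟩
    change (if hz : _ then _ else _) = _
    rw [dif_pos hz]
    exact wd _ _ _ _ hz.choose_spec.1 hs hz.choose_spec.2.1 hz.choose_spec.2.2
  refine ⟨⟨X', ?_⟩, hX'⟩
  intro p q hpq
  by_cases hz : ∃ z : ι × ι, (L z.1 ↔ L z.2) ∧ ρ z.1 = p ∧ ρ z.2 = q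
  · obtain ⟨⟨x, y⟩, hs, rfl, rfl⟩ := hz
    rw [hX' x y hs]
    by_cases hx : L x
    · have hy : L y := hs.1 hx
      obtain ⟨y₁, hy₁, e1, hn⟩ := h.left_forced x y hx hy hpq
      have e := hX x y₁ hx hy₁ (h.partner_T y y₁ hy hy₁ e1.symm)
      rw [h.apply_mul_of_partner hM (row hx) hy₁ hy e1.symm] at e
      rw [← e]
      by_cases hp : ∃ x₁, ¬L x₁ ∧ ρ x₁ = ρ x
      · obtain ⟨x₁, hx₁, e2⟩ := hp
        rw [h.mul_apply_of_partner hM (col hy₁) hx hx₁ e2]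
        exact X.2 _ _ (hn x₁ hx₁ e2)
      · exact mul_apply_of_no_partner hM (col hy₁) hx fun x₁ hx₁ he => hp ⟨x₁, hx₁, he⟩
    · have hy : ¬L y := fun hy => hx (hs.2 hy)
      by_cases hP : P x y
      · obtain ⟨hT, ⟨x₀, hx₀, e1⟩, hn⟩ := h.right_forced x y hx hy hP hpq
        have e := hX x₀ y hx₀ hy hT
        rwa [h.mul_apply_of_partner hM (col hy) hx₀ hx e1.symm,
          apply_mul_of_no_partner hM (row hx₀) hy hn] at e
      · exact X.2 _ _ hP
  · exact dif_neg hz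

/-- Conversely, the pull-backs are orthogonal to the ideal. -/
theorem comm_pullback (h : Fold P P' L T ρ) {M : Matrix ι ι ℂ}
    (hM : ∀ x y, L x → ¬L y → M x y = if ρ x = ρ y then 1 else 0) (X : supported P')
    {x y : ι} (hx : L x) (hy : ¬L y) (hT : T y) :
    (M * pullback L ρ X.1) x y = (pullback L ρ X.1 * M) x y := by
  have col : ∀ u, L u → pullback L ρ X.1 u y = 0 := fun u hu => pullback_diff _ (by tauto)
  have row : ∀ u, ¬L u → pullback L ρ X.1 x u = 0 := fun u hu => pullback_diff _ (by tauto)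
  by_cases h1 : ∃ x₁, ¬L x₁ ∧ ρ x₁ = ρ x <;> by_cases h2 : ∃ y₀, L y₀ ∧ ρ y₀ = ρ y
  · obtain ⟨x₁, hx₁, e1⟩ := h1
    obtain ⟨y₀, hy₀, e2⟩ := h2
    rw [h.mul_apply_of_partner hM col hx hx₁ e1, h.apply_mul_of_partner hM row hy hy₀ e2,
      pullback_same _ (by tauto), pullback_same _ (by tauto), e1, e2]
  · have hn : ¬P' (ρ x) (ρ y) := fun hP => h2 ((h.cross x y hx hy hT hP).1 h1)
    obtain ⟨x₁, hx₁, e1⟩ := h1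
    rw [h.mul_apply_of_partner hM col hx hx₁ e1,
      apply_mul_of_no_partner hM row hy fun y₀ hy₀ he => h2 ⟨y₀, hy₀, he⟩,
      pullback_same _ (by tauto), e1]
    exact X.2 _ _ hn
  · have hn : ¬P' (ρ x) (ρ y) := fun hP => h1 ((h.cross x y hx hy hT hP).2 h2)
    obtain ⟨y₀, hy₀, e2⟩ := h2
    rw [mul_apply_of_no_partner hM col hx fun x₁ hx₁ he => h1 ⟨x₁, hx₁, he⟩,
      h.apply_mul_of_partner hM row hy hy₀ e2, pullback_same _ (by tauto), e2]
    exact (X.2 _ _ hn).symm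
  · rw [mul_apply_of_no_partner hM col hx fun x₁ hx₁ he => h1 ⟨x₁, hx₁, he⟩,
      apply_mul_of_no_partner hM row hy fun y₀ hy₀ he => h2 ⟨y₀, hy₀, he⟩]

theorem ideal_mul_eq_zero {A Y : supported P} (hA : A ∈ ideal P L) (hY : Y ∈ ideal P L) :
    A.1 * Y.1 = 0 := by
  ext x y
  rw [Matrix.mul_apply]
  refine Finset.sum_eq_zero fun z _ => ?_
  by_cases hz : L z
  · rw [mem_ideal.1 hY z y (by tauto), mul_zero]
  · rw [mem_ideal.1 hA x z (by tauto), zero_mul]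

/-- The ideal meets the radical trivially: an entry of `A` in row `y` and column `x` is detected by
an elementary matrix at the partner of `y` or at the partner of `x`. -/
theorem eq_zero_of_mem_ideal (h : Fold P P' L T ρ) {M : Matrix ι ι ℂ}
    (hM : ∀ x y, L x → ¬L y → M x y = if ρ x = ρ y then 1 else 0) {A : supported P}
    (hA : A ∈ ideal P L) (hA' : ∀ Y, traceForm P M A Y = 0) : A = 0 := by
  ext y x
  change A.1 y x = 0
  by_cases hxy : ¬L y ∧ L x
  · obtain ⟨hy, hx⟩ := hxy
    by_cases hT : T y
    · have row : ∀ {x}, L x → ∀ N : Matrix ι ι ℂ, ∀ z, (A.1 * N) x z = 0 := fun hx N z => by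
        rw [Matrix.mul_apply]
        exact Finset.sum_eq_zero fun u _ => by rw [mem_ideal.1 hA _ _ (by tauto), zero_mul]
      have col : ∀ {x}, ¬L x → ∀ N : Matrix ι ι ℂ, ∀ z, (N * A.1) z x = 0 := fun hx N z => by
        rw [Matrix.mul_apply]
        exact Finset.sum_eq_zero fun u _ => by rw [mem_ideal.1 hA _ _ (by tauto), mul_zero]
      by_cases hp : ∃ y₀, L y₀ ∧ ρ y₀ = ρ y
      · obtain ⟨y₀, hy₀, e⟩ := hp
        have := hA' ⟨_, single_mem_supported (h.left_left x y₀ hx hy₀) 1⟩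
        rwa [traceForm_single _ _ (h.left_left x y₀ hx hy₀), row hy₀, sub_zero,
          h.mul_apply_of_partner hM (fun u hu => mem_ideal.1 hA u x (by tauto)) hy₀ hy
            e.symm] at this
      · obtain ⟨x₁, hx₁, e⟩ := (h.partner_or x y hx hy hT).resolve_right hp
        have hP : P x₁ y := h.partner_P x x₁ y hx hx₁ hy e.symm hT fun x' hx' he =>
          hp ⟨x', hx', he⟩
        have := hA' ⟨_, single_mem_supported hP 1⟩
        rwa [traceForm_single _ _ hP, col hx₁, zero_sub, neg_eq_zero,
          h.apply_mul_of_partner hM (fun u hu => mem_ideal.1 hA y u (by tauto)) hx₁ hx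
            e.symm] at this
    · exact A.2 _ _ fun hP => hT ((h.right_left y x hy hx).1 hP)
  · exact hA _ _ hxy

open Classical in
/-- Folding preserves the dimension of the radical: the block of right rows and left columns is an
isotropic subspace, and its orthogonal consists of the pull-backs of the matrices on the folded
index set, up to that block. -/
theorem radDim_eq (h : Fold P P' L T ρ) {M : Matrix ι ι ℂ} {M' : Matrix ι' ι' ℂ}
    (hM : ∀ x y, L x → ¬L y → M x y = if ρ x = ρ y then 1 else 0)
    (hM' : ∀ p q, M' p q = ∑ x, ∑ y, if (L x ↔ L y) ∧ ρ x = p ∧ ρ y = q then M x y else 0) :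
    radDim P M = radDim P' M' := by
  refine finrank_ker_eq_of_isotropic_reduction _ _ (traceForm_swap P M) h.pullbackSupported
    (ideal P L) ?_ ?_ ?_ fun x hx hx' => h.eq_zero_of_mem_ideal hM hx hx'
  · intro X
    constructor
    · intro hX
      obtain ⟨X', hX'⟩ := h.exists_pullback hM X fun x y hx hy hT => by
        have hP := (h.right_left y x hy hx).2 hT
        rw [← sub_eq_zero, ← traceForm_single M X hP]
        refine hX _ fun u v huv => Matrix.single_apply_of_ne _ _ _ _ _ ?_
        rintro ⟨rfl, rfl⟩
        exact huv ⟨hy, hx⟩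
      refine Submodule.mem_sup.2 ⟨_, ⟨X', rfl⟩, X - h.pullbackSupported X', ?_, by abel⟩
      intro x y hxy
      change X.1 x y - pullback L ρ X'.1 x y = 0
      by_cases hs : L x ↔ L y
      · rw [pullback_same _ hs, hX' x y hs, sub_self]
      · rw [pullback_diff _ hs, h.supported_left_right X (by tauto) (by tauto), sub_zero]
    · intro hX Y hY
      obtain ⟨_, ⟨X', rfl⟩, A, hA, rfl⟩ := Submodule.mem_sup.1 hX
      rw [map_add, LinearMap.add_apply, traceForm_apply P M A, ideal_mul_eq_zero hA hY,
        ideal_mul_eq_zero hY hA, sub_zero, Matrix.mul_zero, Matrix.trace_zero, add_zero,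
        traceForm_apply', h.pullbackSupported_coe]
      refine Finset.sum_eq_zero fun x _ => ?_
      rw [Matrix.diag_apply, Matrix.mul_apply]
      refine Finset.sum_eq_zero fun y _ => ?_
      by_cases hxy : ¬L y ∧ L x
      · by_cases hT : T y
        · rw [Matrix.sub_apply, h.comm_pullback hM X' hxy.2 hxy.1 hT, sub_self, zero_mul]
        · rw [Y.2 y x fun hP => hT ((h.right_left y x hxy.1 hxy.2).1 hP), mul_zero]
      · rw [mem_ideal.1 hY y x hxy, mul_zero]
  · intro X hX
    ext p q
    change X.1 p q = 0
    by_cases hP : P' p q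
    · obtain ⟨x, y, hs, rfl, rfl⟩ := h.lift p q hP
      rw [← pullback_same X.1 hs]
      exact hX x y (by tauto)
    · exact X.2 _ _ hP
  · intro X Y
    rw [traceForm_apply, traceForm_apply, h.pullbackSupported_coe, h.pullbackSupported_coe,
      h.pullback_mul X.2 Y.2, h.pullback_mul Y.2 X.2, ← map_sub, trace_mul_pullback hM']

end Algebra

end Fold

/-! ### A lower bound for the index from a transversal slice -/

theorem kirillovForm_apply {L : Type*} [LieRing L] [LieAlgebra ℂ L] (f : Module.Dual ℂ L)
    (x y : L) : kirillovForm f x y = f ⁅x, y⁆ := rfl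

theorem finrank_ker_eq_of_isometry {V V' : Type*} [AddCommGroup V] [Module ℂ V] [AddCommGroup V']
    [Module ℂ V'] (B : V →ₗ[ℂ] V →ₗ[ℂ] ℂ) (B' : V' →ₗ[ℂ] V' →ₗ[ℂ] ℂ) (e : V ≃ₗ[ℂ] V') {c : ℂ}
    (hc : c ≠ 0) (h : ∀ x y, B x y = c * B' (e x) (e y)) :
    Module.finrank ℂ (LinearMap.ker B) = Module.finrank ℂ (LinearMap.ker B') := by
  have hk : LinearMap.ker B = (LinearMap.ker B').comap e.toLinearMap := by
    ext x
    rw [Submodule.mem_comap, LinearMap.mem_ker, LinearMap.mem_ker]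
    constructor
    · intro hx
      ext y
      have := h x (e.symm y)
      rw [hx, e.apply_symm_apply, LinearMap.zero_apply, eq_comm] at this
      exact (mul_eq_zero.1 this).resolve_left hc
    · intro hx
      ext y
      rw [h, LinearEquiv.coe_coe] at *
      rw [hx, LinearMap.zero_apply, LinearMap.zero_apply, mul_zero]
  rw [hk]
  exact (e.submoduleMap _).finrank_eq.trans (by
    rw [show Submodule.map (e : V →ₗ[ℂ] V') ((LinearMap.ker B').comap e.toLinearMap)
      = LinearMap.ker B' from Submodule.map_comap_eq_of_surjective e.surjective _])

theorem kernelDim_comp {L L' : Type*} [LieRing L] [LieAlgebra ℂ L] [LieRing L'] [LieAlgebra ℂ L']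
    (e : L ≃ₗ[ℂ] L') (he : ∀ x y, e ⁅x, y⁆ = ⁅e x, e y⁆) (f : Module.Dual ℂ L') :
    kernelDim (f.comp e.toLinearMap) = kernelDim f :=
  finrank_ker_eq_of_isometry _ _ e one_ne_zero fun x y => by
    simp [kirillovForm_apply, he]

theorem lieIndex_le {L : Type*} [LieRing L] [LieAlgebra ℂ L] (f : Module.Dual ℂ L) :
    lieIndex L ≤ kernelDim f := ciInf_le (OrderBot.bddBelow _) f

theorem exists_kernelDim_eq_lieIndex (L : Type*) [LieRing L] [LieAlgebra ℂ L] :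
    ∃ f : Module.Dual ℂ L, kernelDim f = lieIndex L :=
  Nat.sInf_mem (Set.range_nonempty _)

open Filter Topology

/-- In a pencil of linear maps, the generic kernel is no larger than that of any given member. -/
theorem eventually_finrank_ker_sub_smul_le {V U : Type*} [AddCommGroup V] [Module ℂ V]
    [FiniteDimensional ℂ V] [AddCommGroup U] [Module ℂ U] (S T : V →ₗ[ℂ] U) :
    ∀ᶠ μ : ℂ in 𝓝[≠] 0, Module.finrank ℂ (LinearMap.ker (S - μ • T))
      ≤ Module.finrank ℂ (LinearMap.ker T) := by
  -- On a complement `C` of `ker T` the map `T` has a left inverse `q`, and `ker (S - μ T)` can only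
  -- meet `C` if `μ` is one of the finitely many eigenvalues of `q S`.
  obtain ⟨C, hC⟩ := (LinearMap.ker T).exists_isCompl
  have hinj : LinearMap.ker (T.comp C.subtype) = ⊥ := by
    refine (Submodule.eq_bot_iff _).2 fun x hx => ?_
    have : x.1 ∈ LinearMap.ker T ⊓ C := ⟨hx, x.2⟩
    rw [hC.inf_eq_bot] at this
    exact Subtype.ext this
  obtain ⟨q, hq⟩ := (T.comp C.subtype).exists_leftInverse_of_injective hinj
  have hfin : {μ : ℂ | Module.End.HasEigenvalue (q.comp (S.comp C.subtype)) μ}.Finite :=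
    Module.End.finite_hasEigenvalue _
  have hev : ∀ᶠ μ : ℂ in 𝓝[≠] 0,
      ¬Module.End.HasEigenvalue (q.comp (S.comp C.subtype)) μ := by
    have h0 :
        ({μ : ℂ | Module.End.HasEigenvalue (q.comp (S.comp C.subtype)) μ} \ {0})ᶜ ∈ 𝓝 (0 : ℂ) :=
      (hfin.subset Set.sdiff_subset).isClosed.isOpen_compl.mem_nhds (by simp)
    filter_upwards [mem_nhdsWithin_of_mem_nhds h0, self_mem_nhdsWithin] with μ h1 h2 h3
    exact h1 ⟨h3, h2⟩
  filter_upwards [hev] with μ hμ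
  have hd : LinearMap.ker (S - μ • T) ⊓ C = ⊥ := by
    refine (Submodule.eq_bot_iff _).2 fun x hx => ?_
    by_contra hne
    refine hμ (Module.End.hasEigenvalue_of_hasEigenvector (x := (⟨x, hx.2⟩ : C)) ⟨?_, ?_⟩)
    · rw [Module.End.mem_eigenspace_iff]
      have h1 : S x = μ • T x := by
        have := LinearMap.mem_ker.1 hx.1
        rwa [LinearMap.sub_apply, LinearMap.smul_apply, sub_eq_zero] at this
      have h2 := LinearMap.congr_fun hq ⟨x, hx.2⟩
      simp only [LinearMap.comp_apply, Submodule.subtype_apply, LinearMap.id_apply] at h2 ⊢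
      rw [h1, map_smul, h2]
    · exact fun h => hne (congrArg Subtype.val h)
  have d1 := Submodule.finrank_sup_add_finrank_inf_eq (LinearMap.ker (S - μ • T)) C
  have d2 := Submodule.finrank_add_eq_of_isCompl hC
  have d3 := Submodule.finrank_le (LinearMap.ker (S - μ • T) ⊔ C)
  rw [hd, finrank_bot] at d1
  omega

section Slice

variable {A : Type*} [NormedRing A] [NormedAlgebra ℂ A] [FiniteDimensional ℂ A]

/-- Conjugation by a unit. -/
def unitConj (u : Aˣ) : A ≃ₗ[ℂ] A where
  toFun y := ↑u⁻¹ * (y * u)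
  invFun y := u * (y * ↑u⁻¹)
  map_add' y z := by simp [add_mul, mul_add]
  map_smul' c y := by simp
  left_inv y := by simp [mul_assoc]
  right_inv y := by simp [mul_assoc]

theorem unitConj_lie (u : Aˣ) (y z : A) : unitConj u ⁅y, z⁆ = ⁅unitConj u y, unitConj u z⁆ := by
  simp [unitConj, Ring.lie_def, mul_assoc, sub_mul, mul_sub]

variable {W : Type*} [NormedAddCommGroup W] [NormedSpace ℂ W] [FiniteDimensional ℂ W]

/-- If the affine slice `f₀ + H(W)` is transversal at `f₀` to the coadjoint orbit of `f₀`, then by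
the open mapping theorem every functional near `f₀` is conjugate to one in the slice. So a lower
bound for the kernel dimensions on the slice holds near `f₀`, and hence everywhere. -/
theorem le_kernelDim_of_slice (f₀ : Module.Dual ℂ A) (H : W →ₗ[ℂ] Module.Dual ℂ A)
    (hsurj : LinearMap.range H ⊔ LinearMap.range (kirillovForm f₀) = ⊤) (k : ℕ)
    (hk : ∀ w, k ≤ kernelDim (f₀ + H w)) (f : Module.Dual ℂ A) : k ≤ kernelDim f := by
  have : CompleteSpace A := FiniteDimensional.complete ℂ A
  have : CompleteSpace W := FiniteDimensional.complete ℂ W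
  let toC : Module.Dual ℂ A ≃ₗ[ℂ] (A →L[ℂ] ℂ) := LinearMap.toContinuousLinearMap
  have toC_apply : ∀ g y, toC g y = g y := fun _ _ => rfl
  let Hc : W →L[ℂ] (A →L[ℂ] ℂ) := LinearMap.toContinuousLinearMap (toC.toLinearMap.comp H)
  have Hc_apply : ∀ w y, Hc w y = H w y := fun _ _ => rfl
  let l : A →L[ℂ] A →L[ℂ] A := ContinuousLinearMap.mul ℂ A
  -- The functional `φ (u, w)` is `f₀ + H w` conjugated by `u`; `Ring.inverse u` is `0` if `u` is
  -- not a unit, which does not occur near `u = 1`.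
  let φ : A × W → (A →L[ℂ] ℂ) := fun z =>
    (toC f₀ + Hc z.2).comp ((l (Ring.inverse z.1)).comp (l.flip z.1))
  have d1 : HasStrictFDerivAt (fun z : A × W => toC f₀ + Hc z.2)
      (Hc.comp (ContinuousLinearMap.snd ℂ A W)) (1, 0) :=
    (Hc.hasStrictFDerivAt.comp _ hasStrictFDerivAt_snd).const_add _
  have d2 : HasStrictFDerivAt (fun z : A × W => Ring.inverse z.1) _ (1, 0) :=
    (hasStrictFDerivAt_ringInverse (𝕜 := ℂ) (1 : Aˣ)).comp ((1, 0) : A × W)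
      hasStrictFDerivAt_fst
  have d3 := (l.hasStrictFDerivAt.comp _ d2).clm_comp
    (l.flip.hasStrictFDerivAt.comp ((1, 0) : A × W) hasStrictFDerivAt_fst)
  have d4 := d1.clm_comp d3
  have h1 : φ (1, 0) = toC f₀ := by
    ext y
    simp [φ, l]
  have hopen := d4.map_nhds_eq_of_surj (by
    rw [LinearMap.range_eq_top]
    intro g
    have hg : toC.symm g ∈ LinearMap.range H ⊔ LinearMap.range (kirillovForm f₀) := by
      rw [hsurj]
      trivial
    obtain ⟨_, ⟨w, rfl⟩, _, ⟨x, rfl⟩, hwx⟩ := Submodule.mem_sup.1 hg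
    refine ⟨(-x, w), ?_⟩
    ext y
    have e : g y = H w y + kirillovForm f₀ x y := by
      rw [← LinearMap.add_apply, hwx]
      rfl
    rw [e, kirillovForm_apply, Ring.lie_def]
    simp [l, toC_apply, Hc_apply]
    ring)
  change map φ _ = 𝓝 (φ (1, 0)) at hopen
  rw [h1] at hopen
  have hunit : ∀ᶠ z : A × W in 𝓝 (1, 0), IsUnit z.1 :=
    continuousAt_fst.eventually (Units.nhds (1 : Aˣ))
  have hnear : ∀ᶠ g in 𝓝 (toC f₀), k ≤ kernelDim (toC.symm g) := by
    rw [← hopen, eventually_map]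
    filter_upwards [hunit] with z hz
    obtain ⟨u, hu⟩ := hz
    have : toC.symm (φ z) = (f₀ + H z.2).comp (unitConj u).toLinearMap := by
      ext y
      change (f₀ + H z.2) (Ring.inverse z.1 * (y * z.1)) = (f₀ + H z.2) (↑u⁻¹ * (y * u))
      rw [← hu, Ring.inverse_unit]
    rw [this, kernelDim_comp _ (unitConj_lie u)]
    exact hk _
  -- The functional `f₀ - μ f` is near `f₀` for small `μ`, and has a kernel no larger than that of
  -- `f` for almost all `μ`.
  have hline : Tendsto (fun μ : ℂ => toC f₀ - μ • toC f) (𝓝[≠] 0) (𝓝 (toC f₀)) := by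
    refine tendsto_nhdsWithin_of_tendsto_nhds ?_
    have : Continuous fun μ : ℂ => toC f₀ - μ • toC f := by fun_prop
    convert this.tendsto 0 using 2
    ext y
    simp
  obtain ⟨μ, hμ1, hμ2⟩ := ((hline.eventually hnear).and
    (eventually_finrank_ker_sub_smul_le (kirillovForm f₀) (kirillovForm f))).exists
  refine hμ1.trans (le_of_eq_of_le ?_ hμ2)
  have : kirillovForm (toC.symm (toC f₀ - μ • toC f)) = kirillovForm f₀ - μ • kirillovForm f := by
    rw [map_sub, map_smul, LinearEquiv.symm_apply_apply, LinearEquiv.symm_apply_apply]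
    ext x y
    simp [kirillovForm_apply]
  rw [kernelDim, this]

end Slice

/-! ### Transport, transposition and direct sums of trace forms -/

section Transport

variable {ι ι' : Type*} [Fintype ι] [Fintype ι']

/-- Reindexing, as an equivalence of matrices with prescribed supports. -/
def supportedReindex (e : ι ≃ ι') {P : ι → ι → Prop} {P' : ι' → ι' → Prop}
    (hP : ∀ x y, P' (e x) (e y) ↔ P x y) : supported P ≃ₗ[ℂ] supported P' :=
  (Matrix.reindexLinearEquiv ℂ ℂ e e).ofSubmodules _ _ (by
    ext X
    constructor
    · rintro ⟨Y, hY, rfl⟩ x y hxy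
      refine hY _ _ fun h => hxy ?_
      have := (hP (e.symm x) (e.symm y)).2 h
      rwa [e.apply_symm_apply, e.apply_symm_apply] at this
    · intro hX
      refine ⟨Matrix.reindexLinearEquiv ℂ ℂ e.symm e.symm X, fun x y hxy => ?_, ?_⟩
      · exact hX _ _ fun h => hxy ((hP x y).1 h)
      · ext x y
        simp)

theorem radDim_reindex (e : ι ≃ ι') {P : ι → ι → Prop} {P' : ι' → ι' → Prop}
    (hP : ∀ x y, P' (e x) (e y) ↔ P x y) {M : Matrix ι ι ℂ} {M' : Matrix ι' ι' ℂ}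
    (hM : ∀ x y, M' (e x) (e y) = M x y) : radDim P M = radDim P' M' := by
  refine finrank_ker_eq_of_isometry _ _ (supportedReindex e hP) one_ne_zero fun X Y => ?_
  have hM' : M' = Matrix.reindex e e M := by
    ext x y
    rw [Matrix.reindex_apply, Matrix.submatrix_apply, ← hM, e.apply_symm_apply, e.apply_symm_apply]
  rw [one_mul, traceForm_apply, traceForm_apply, hM']
  change _ = (Matrix.reindex e e M * (Matrix.reindex e e X.1 * Matrix.reindex e e Y.1 -
    Matrix.reindex e e Y.1 * Matrix.reindex e e X.1)).trace
  have tr : ∀ A : Matrix ι ι ℂ, (A.submatrix e.symm e.symm).trace = A.trace :=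
    fun A => e.symm.sum_comp fun i => A i i
  simp only [Matrix.reindex_apply, Matrix.submatrix_mul_equiv, Matrix.mul_sub, Matrix.trace_sub, tr]

theorem radDim_transpose {P P' : ι → ι → Prop} (hP : ∀ x y, P' y x ↔ P x y)
    {M M' : Matrix ι ι ℂ} (hM : ∀ x y, M' y x = M x y) : radDim P M = radDim P' M' := by
  let e : supported P ≃ₗ[ℂ] supported P' :=
    (Matrix.transposeLinearEquiv ι ι ℂ ℂ).ofSubmodules _ _ (by
      ext X
      constructor
      · rintro ⟨Y, hY, rfl⟩ x y hxy
        exact hY _ _ fun h => hxy ((hP _ _).2 h)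
      · intro hX
        exact ⟨X.transpose, fun x y hxy => hX _ _ fun h => hxy ((hP _ _).1 h),
          X.transpose_transpose⟩)
  refine finrank_ker_eq_of_isometry _ _ e (neg_ne_zero.2 one_ne_zero) fun X Y => ?_
  have hM' : M' = M.transpose := by
    ext x y
    exact hM y x
  rw [traceForm_apply, traceForm_apply, hM']
  change _ = -1 * (M.transpose * (X.1.transpose * Y.1.transpose -
    Y.1.transpose * X.1.transpose)).trace
  rw [← Matrix.transpose_mul, ← Matrix.transpose_mul, ← Matrix.transpose_sub,
    ← Matrix.transpose_mul, Matrix.trace_transpose, Matrix.trace_mul_comm M, neg_one_mul,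
    ← Matrix.trace_neg, ← Matrix.neg_mul, neg_sub]

theorem radDim_smul {P : ι → ι → Prop} {M : Matrix ι ι ℂ} {c : ℂ} (hc : c ≠ 0) :
    radDim P (c • M) = radDim P M :=
  finrank_ker_eq_of_isometry _ _ (LinearEquiv.refl ℂ _) hc fun X Y => by
    simp [traceForm_apply]

/-- A product of submodules, as a product of modules. -/
def prodSubmoduleEquiv {V W : Type*} [AddCommGroup V] [Module ℂ V] [AddCommGroup W] [Module ℂ W]
    (p : Submodule ℂ V) (q : Submodule ℂ W) : p.prod q ≃ₗ[ℂ] p × q where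
  toFun x := (⟨x.1.1, x.2.1⟩, ⟨x.1.2, x.2.2⟩)
  invFun x := ⟨(x.1.1, x.2.1), x.1.2, x.2.2⟩
  map_add' _ _ := rfl
  map_smul' _ _ := rfl
  left_inv _ := rfl
  right_inv _ := rfl

theorem finrank_prodSubmodule {V W : Type*} [AddCommGroup V] [Module ℂ V] [AddCommGroup W]
    [Module ℂ W] [FiniteDimensional ℂ V] [FiniteDimensional ℂ W]
    (p : Submodule ℂ V) (q : Submodule ℂ W) :
    Module.finrank ℂ (p.prod q) = Module.finrank ℂ p + Module.finrank ℂ q := by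
  rw [(prodSubmoduleEquiv p q).finrank_eq, Module.finrank_prod]

theorem fromBlocks_trace (A : Matrix ι ι ℂ) (B : Matrix ι ι' ℂ) (C : Matrix ι' ι ℂ)
    (D : Matrix ι' ι' ℂ) : (Matrix.fromBlocks A B C D).trace = A.trace + D.trace := by
  simp [Matrix.trace, Fintype.sum_sum_type]

theorem radDim_sum {P₁ : ι → ι → Prop} {P₂ : ι' → ι' → Prop} {P : ι ⊕ ι' → ι ⊕ ι' → Prop}
    (h₁ : ∀ x y, P (.inl x) (.inl y) ↔ P₁ x y) (h₂ : ∀ x y, P (.inr x) (.inr y) ↔ P₂ x y)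
    (h₁₂ : ∀ x y, ¬P (.inl x) (.inr y)) (h₂₁ : ∀ x y, ¬P (.inr x) (.inl y))
    (M : Matrix (ι ⊕ ι') (ι ⊕ ι') ℂ) :
    radDim P M = radDim P₁ M.toBlocks₁₁ + radDim P₂ M.toBlocks₂₂ := by
  let e : (supported P₁ × supported P₂) ≃ₗ[ℂ] supported P :=
    { toFun := fun X => ⟨Matrix.fromBlocks X.1.1 0 0 X.2.1, by
        rintro (x | x) (y | y) hxy
        · exact X.1.2 x y fun h => hxy ((h₁ x y).2 h)
        · rfl
        · rfl
        · exact X.2.2 x y fun h => hxy ((h₂ x y).2 h)⟩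
      invFun := fun X => (⟨X.1.toBlocks₁₁, fun x y hxy => X.2 _ _ fun h => hxy ((h₁ x y).1 h)⟩,
        ⟨X.1.toBlocks₂₂, fun x y hxy => X.2 _ _ fun h => hxy ((h₂ x y).1 h)⟩)
      map_add' := fun X Y => by
        ext (x | x) (y | y) <;> simp
      map_smul' := fun c X => by
        ext (x | x) (y | y) <;> simp
      left_inv := fun X => rfl
      right_inv := fun X => by
        ext (x | x) (y | y)
        · rfl
        · exact (X.2 _ _ (h₁₂ x y)).symm
        · exact (X.2 _ _ (h₂₁ x y)).symm
        · rfl }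
  have he : ∀ X Y, traceForm P M (e X) (e Y) =
      traceForm P₁ M.toBlocks₁₁ X.1 Y.1 + traceForm P₂ M.toBlocks₂₂ X.2 Y.2 := by
    intro X Y
    rw [traceForm_apply, traceForm_apply, traceForm_apply]
    change (M * (Matrix.fromBlocks X.1.1 0 0 X.2.1 * Matrix.fromBlocks Y.1.1 0 0 Y.2.1 -
      Matrix.fromBlocks Y.1.1 0 0 Y.2.1 * Matrix.fromBlocks X.1.1 0 0 X.2.1)).trace = _
    conv_lhs => rw [← M.fromBlocks_toBlocks]
    simp only [Matrix.fromBlocks_multiply, Matrix.mul_sub, Matrix.trace_sub, fromBlocks_trace,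
      Matrix.mul_zero, Matrix.zero_mul, add_zero, zero_add]
    ring
  have hk : LinearMap.ker (traceForm P M) = ((LinearMap.ker (traceForm P₁ M.toBlocks₁₁)).prod
      (LinearMap.ker (traceForm P₂ M.toBlocks₂₂))).map e.toLinearMap := by
    ext Z
    obtain ⟨X, rfl⟩ := e.surjective Z
    rw [Submodule.mem_map_equiv, e.symm_apply_apply, Submodule.mem_prod, LinearMap.mem_ker,
      LinearMap.mem_ker, LinearMap.mem_ker]
    constructor
    · intro h
      constructor
      · ext Y
        have := he X (Y, 0)
        rw [h, map_zero, add_zero] at this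
        exact this.symm
      · ext Y
        have := he X (0, Y)
        rw [h, map_zero, zero_add] at this
        exact this.symm
    · rintro ⟨hX₁, hX₂⟩
      ext Z
      obtain ⟨Y, rfl⟩ := e.surjective Z
      rw [he, hX₁, hX₂]
      simp
  rw [radDim, hk, (e.submoduleMap _).finrank_eq.symm,
    finrank_prodSubmodule]
  rfl

end Transport

/-! ### Blowing up the vertices of a meander -/

section BlowUp

variable {V V' : Type*}

/-- The index set in which each vertex `v` is replaced by `c v` indices. -/
abbrev BlowUp (c : V → ℕ) : Type _ := Σ v, Fin (c v)

theorem blowUp_ext {c : V → ℕ} {x y : BlowUp c} :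
    x = y ↔ x.1 = y.1 ∧ (x.2 : ℕ) = y.2 := by
  obtain ⟨x, s⟩ := x
  obtain ⟨y, r⟩ := y
  constructor
  · intro h
    cases h
    exact ⟨rfl, rfl⟩
  · rintro ⟨h1, h2⟩
    dsimp only at h1 h2
    subst h1
    rw [Fin.ext h2]

/-- The map between blown-up index sets induced by a map of vertices. -/
def blowMap {c : V → ℕ} {c' : V' → ℕ} {ρ : V → V'} (hc : ∀ v, c' (ρ v) = c v) (x : BlowUp c) :
    BlowUp c' :=
  ⟨ρ x.1, Fin.cast (hc x.1).symm x.2⟩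

theorem blowMap_eq_iff {c : V → ℕ} {c' : V' → ℕ} {ρ : V → V'} (hc : ∀ v, c' (ρ v) = c v)
    {x : BlowUp c} {p : BlowUp c'} :
    blowMap hc x = p ↔ ρ x.1 = p.1 ∧ (x.2 : ℕ) = p.2 := by
  rw [blowUp_ext]
  rfl

theorem exists_blowMap_iff {c : V → ℕ} {c' : V' → ℕ} {ρ : V → V'} (hc : ∀ v, c' (ρ v) = c v)
    {Q : V → Prop} {p : BlowUp c'} :
    (∃ x : BlowUp c, Q x.1 ∧ blowMap hc x = p) ↔ ∃ v, Q v ∧ ρ v = p.1 := by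
  constructor
  · rintro ⟨x, hx, hp⟩
    exact ⟨x.1, hx, ((blowMap_eq_iff hc).1 hp).1⟩
  · rintro ⟨v, hv, hp⟩
    exact ⟨⟨v, Fin.cast (by rw [← hc, hp]) p.2⟩, hv, (blowMap_eq_iff hc).2 ⟨hp, rfl⟩⟩

theorem Fold.blowUp {P : V → V → Prop} {P' : V' → V' → Prop} {L T : V → Prop} {ρ : V → V'}
    (h : Fold P P' L T ρ) {c : V → ℕ} {c' : V' → ℕ} (hc : ∀ v, c' (ρ v) = c v) :
    Fold (fun x y : BlowUp c => P x.1 y.1) (fun x y : BlowUp c' => P' x.1 y.1)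
      (fun x => L x.1) (fun x => T x.1) (blowMap hc) where
  inj x y hs hp := by
    have hp := (blowMap_eq_iff hc).1 hp
    exact blowUp_ext.2 ⟨h.inj _ _ hs hp.1, hp.2⟩
  surj p := by
    obtain ⟨v, hv⟩ := h.surj p.1
    obtain ⟨x, -, hx⟩ := (exists_blowMap_iff hc (Q := fun _ => True)).2 ⟨v, trivial, hv⟩
    exact ⟨x, hx⟩
  left_left x y := h.left_left _ _
  left_right x y := h.left_right _ _
  right_left x y := h.right_left _ _
  partner_T x y hx hy hp := h.partner_T _ _ hx hy ((blowMap_eq_iff hc).1 hp).1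
  pull x y := h.pull _ _
  right_forced x y hx hy hP hP' := by
    obtain ⟨h1, h2, h3⟩ := h.right_forced _ _ hx hy hP hP'
    exact ⟨h1, (exists_blowMap_iff hc (p := blowMap hc x)).2 h2,
      fun y₀ hy₀ hp => h3 _ hy₀ ((blowMap_eq_iff hc).1 hp).1⟩
  left_forced x y hx hy hP' := by
    obtain ⟨v, h1, h2, h3⟩ := h.left_forced _ _ hx hy hP'
    refine ⟨⟨v, Fin.cast (by rw [← hc, ← h2, hc]) y.2⟩, h1, (blowMap_eq_iff hc).2 ⟨h2, rfl⟩,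
      fun x₁ hx₁ hp => h3 _ hx₁ ((blowMap_eq_iff hc).1 hp).1⟩
  cross x y hx hy hT hP := by
    rw [exists_blowMap_iff hc (Q := fun v => ¬L v), exists_blowMap_iff hc (Q := L)]
    exact h.cross _ _ hx hy hT hP
  through x y r hs h1 h2 := by
    obtain ⟨z, hz⟩ := h.through _ _ _ hs h1 h2
    exact (exists_blowMap_iff hc (Q := fun v => L v ↔ L x.1)).2 ⟨z, hz⟩
  lift p q hP := by
    obtain ⟨u, v, hs, hu, hv⟩ := h.lift _ _ hP
    exact ⟨⟨u, Fin.cast (by rw [← hc, hu]) p.2⟩, ⟨v, Fin.cast (by rw [← hc, hv]) q.2⟩, hs,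
      (blowMap_eq_iff hc).2 ⟨hu, rfl⟩, (blowMap_eq_iff hc).2 ⟨hv, rfl⟩⟩
  partner_or x y hx hy hT := by
    rw [exists_blowMap_iff hc (Q := fun v => ¬L v), exists_blowMap_iff hc (Q := L)]
    exact h.partner_or _ _ hx hy hT
  partner_P x y y' hx hy hy' hp hT hn := by
    refine h.partner_P x.1 y.1 y'.1 hx hy hy' ((blowMap_eq_iff hc).1 hp).1 hT fun v hv he => ?_
    obtain ⟨z, hz, hz'⟩ := (exists_blowMap_iff hc (Q := L) (p := blowMap hc y')).2 ⟨v, hv, he⟩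
    exact hn z hz hz'

/-- Compatibility of a folding map with the oriented edges `E` and `E'` of two meanders: the edges
that cross from the right to the left part are those that are contracted, and the other edges
correspond to the edges of the folded meander. -/
structure EdgeFold (E : V → V → Prop) (E' : V' → V' → Prop) (L : V → Prop) (ρ : V → V') :
    Prop where
  right_left : ∀ x y, L x → ¬L y → (E y x ↔ ρ x = ρ y)
  left_right : ∀ x y, L x → ¬L y → ¬E x y
  map : ∀ x y, (L x ↔ L y) → E x y → E' (ρ x) (ρ y)
  lift : ∀ p q, E' p q → ∃ x y, (L x ↔ L y) ∧ ρ x = p ∧ ρ y = q ∧ E x y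
  unique : ∀ x y x' y', L x → L y → ¬L x' → ¬L y' → ρ x = ρ x' → ρ y = ρ y' → E x y → ¬E x' y'

open Classical in
/-- The matrix `M` for which `X ↦ tr (M X)` is the functional attached to a meander with oriented
edges `E`, component labels `lab` and vertex sizes `c`: it is the sum of the coefficients `F i` on
the diagonal blocks of the component `i`, each with a weight `w`, and of the diagonals of the
blocks of the edges. The entry of `M` at `(x, y)` is the coefficient of the matrix entry `X y x`,
whence the exchange of `x` and `y`. -/
noncomputable def meanderMatrix (c : V → ℕ) (E : V → V → Prop) (lab w : V → ℕ)
    (F : ℕ → ℕ → ℕ → ℂ) : Matrix (BlowUp c) (BlowUp c) ℂ := fun x y =>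
  (if y.1 = x.1 then w x.1 * F (lab x.1) y.2 x.2 else 0) +
    if E y.1 x.1 ∧ (y.2 : ℕ) = x.2 then 1 else 0

variable [Fintype V] [Fintype V']

open Classical in
/-- Folding a meander preserves the dimension of the radical, while the weights of identified
vertices are added. -/
theorem radDim_meanderMatrix_fold {P : V → V → Prop} {P' : V' → V' → Prop} {L T : V → Prop}
    {ρ : V → V'} (h : Fold P P' L T ρ) {E : V → V → Prop} {E' : V' → V' → Prop}
    (hE : EdgeFold E E' L ρ) {c : V → ℕ} {c' : V' → ℕ} (hc : ∀ v, c' (ρ v) = c v)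
    {lab : V → ℕ} {lab' : V' → ℕ} (hlab : ∀ v, lab' (ρ v) = lab v) (w : V → ℕ)
    (F : ℕ → ℕ → ℕ → ℂ) :
    radDim (fun x y : BlowUp c => P x.1 y.1) (meanderMatrix c E lab w F) =
      radDim (fun x y : BlowUp c' => P' x.1 y.1)
        (meanderMatrix c' E' lab' (fun p => ∑ v, if ρ v = p then w v else 0) F) := by
  refine (h.blowUp hc).radDim_eq ?_ ?_
  · intro x y hx hy
    have hne : y.1 ≠ x.1 := fun he => hy (he ▸ hx)
    simp only [meanderMatrix, if_neg hne, zero_add]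
    refine if_congr ?_ rfl rfl
    rw [blowMap_eq_iff, hE.right_left x.1 y.1 hx hy]
    exact and_congr Iff.rfl eq_comm
  · intro p q
    -- The diagonal coefficients and the edges are summed over the fibres separately.
    have hD : ∑ x : BlowUp c, ∑ y : BlowUp c,
        (if (L x.1 ↔ L y.1) ∧ blowMap hc x = p ∧ blowMap hc y = q then
          (if y.1 = x.1 then (w x.1 * F (lab x.1) y.2 x.2 : ℂ) else 0) else 0) =
        if q.1 = p.1 then ((∑ v, if ρ v = p.1 then w v else 0 : ℕ) : ℂ) * F (lab' p.1) q.2 p.2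
          else 0 := by
      have inner : ∀ x : BlowUp c, ∑ y : BlowUp c,
          (if (L x.1 ↔ L y.1) ∧ blowMap hc x = p ∧ blowMap hc y = q then
            (if y.1 = x.1 then (w x.1 * F (lab x.1) y.2 x.2 : ℂ) else 0) else 0) =
          if blowMap hc x = p then
            (if q.1 = p.1 then (w x.1 : ℂ) * F (lab' p.1) q.2 p.2 else 0) else 0 := by
        intro x
        by_cases hx : blowMap hc x = p
        · have hx' := (blowMap_eq_iff hc).1 hx
          rw [if_pos hx]
          by_cases hpq : q.1 = p.1
          · rw [if_pos hpq, Finset.sum_eq_single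
              (⟨x.1, Fin.cast (by rw [← hc, hx'.1, hpq]) q.2⟩ : BlowUp c)]
            · have : blowMap hc (⟨x.1, Fin.cast (by rw [← hc, hx'.1, hpq]) q.2⟩ : BlowUp c) = q :=
                (blowMap_eq_iff hc).2 ⟨hx'.1.trans hpq.symm, rfl⟩
              rw [if_pos ⟨Iff.rfl, hx, this⟩, if_pos rfl, ← hlab,
                show lab' (ρ x.1) = lab' p.1 by rw [hx'.1]]
              change (w x.1 : ℂ) * F (lab' p.1) (q.2 : ℕ) (x.2 : ℕ) = _
              rw [hx'.2]
            · intro y _ hy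
              rw [ite_eq_right_iff]
              rintro ⟨-, -, hyq⟩
              rw [if_neg]
              intro he
              exact hy (blowUp_ext.2 ⟨he, ((blowMap_eq_iff hc).1 hyq).2⟩)
            · simp
          · rw [if_neg hpq]
            refine Finset.sum_eq_zero fun y _ => ?_
            rw [ite_eq_right_iff]
            rintro ⟨-, -, hyq⟩
            rw [if_neg]
            intro he
            exact hpq (by rw [← ((blowMap_eq_iff hc).1 hyq).1, he, hx'.1])
        · rw [if_neg hx]
          exact Finset.sum_eq_zero fun y _ => if_neg fun hh => hx hh.2.1
      rw [Finset.sum_congr rfl fun x _ => inner x, Fintype.sum_sigma]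
      have inner2 : ∀ v : V, ∑ s : Fin (c v), (if blowMap hc (⟨v, s⟩ : BlowUp c) = p then
            (if q.1 = p.1 then (w v : ℂ) * F (lab' p.1) q.2 p.2 else 0) else 0) =
          if ρ v = p.1 then
            (if q.1 = p.1 then (w v : ℂ) * F (lab' p.1) q.2 p.2 else 0) else 0 := by
        intro v
        by_cases hv : ρ v = p.1
        · rw [if_pos hv, Finset.sum_eq_single (Fin.cast (by rw [← hc, hv]) p.2)]
          · exact if_pos ((blowMap_eq_iff hc).2 ⟨hv, rfl⟩)
          · intro s _ hs
            exact if_neg fun hh => hs (Fin.ext ((blowMap_eq_iff hc).1 hh).2)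
          · simp
        · rw [if_neg hv]
          exact Finset.sum_eq_zero fun s _ => if_neg fun hh => hv ((blowMap_eq_iff hc).1 hh).1
      rw [Finset.sum_congr rfl fun v _ => inner2 v]
      by_cases hpq : q.1 = p.1
      · simp only [if_pos hpq]
        rw [Nat.cast_sum, Finset.sum_mul]
        refine Finset.sum_congr rfl fun v _ => ?_
        split_ifs <;> simp
      · simp [hpq]
    have hEE : ∑ x : BlowUp c, ∑ y : BlowUp c,
        (if (L x.1 ↔ L y.1) ∧ blowMap hc x = p ∧ blowMap hc y = q then
          (if E y.1 x.1 ∧ (y.2 : ℕ) = x.2 then (1 : ℂ) else 0) else 0) =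
        if E' q.1 p.1 ∧ (q.2 : ℕ) = p.2 then 1 else 0 := by
      by_cases hpq : E' q.1 p.1 ∧ (q.2 : ℕ) = p.2
      · obtain ⟨u, v, hs, hu, hv, huv⟩ := hE.lift _ _ hpq.1
        have hx0 : blowMap hc (⟨v, Fin.cast (by rw [← hc, hv]) p.2⟩ : BlowUp c) = p :=
          (blowMap_eq_iff hc).2 ⟨hv, rfl⟩
        have hy0 : blowMap hc (⟨u, Fin.cast (by rw [← hc, hu]) q.2⟩ : BlowUp c) = q :=
          (blowMap_eq_iff hc).2 ⟨hu, rfl⟩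
        have uniq : ∀ x y : BlowUp c, (L x.1 ↔ L y.1) → blowMap hc x = p → blowMap hc y = q →
            E y.1 x.1 → x.1 = v ∧ y.1 = u := by
          intro x y hs' hx hy hxy
          have hx := ((blowMap_eq_iff hc).1 hx).1.trans hv.symm
          have hy := ((blowMap_eq_iff hc).1 hy).1.trans hu.symm
          by_cases hxv : L x.1 ↔ L v
          · exact ⟨h.inj _ _ hxv hx, h.inj _ _ (by tauto) hy⟩
          · exfalso
            by_cases hLx : L x.1
            · exact hE.unique y.1 x.1 u v (by tauto) hLx (by tauto) (by tauto) hy hx hxy huv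
            · exact hE.unique u v y.1 x.1 (by tauto) (by tauto) (by tauto) hLx hy.symm hx.symm
                huv hxy
        rw [if_pos hpq, Finset.sum_eq_single (⟨v, Fin.cast (by rw [← hc, hv]) p.2⟩ : BlowUp c),
          Finset.sum_eq_single (⟨u, Fin.cast (by rw [← hc, hu]) q.2⟩ : BlowUp c)]
        · rw [if_pos ⟨hs.symm, hx0, hy0⟩, if_pos ⟨huv, hpq.2⟩]
        · intro y _ hy
          rw [ite_eq_right_iff]
          rintro ⟨h1, h2, h3⟩
          rw [if_neg]
          rintro ⟨h4, -⟩
          exact hy (blowUp_ext.2 ⟨(uniq _ y h1 h2 h3 h4).2, ((blowMap_eq_iff hc).1 h3).2⟩)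
        · simp
        · intro x _ hx
          refine Finset.sum_eq_zero fun y _ => ?_
          rw [ite_eq_right_iff]
          rintro ⟨h1, h2, h3⟩
          rw [if_neg]
          rintro ⟨h4, -⟩
          exact hx (blowUp_ext.2 ⟨(uniq x y h1 h2 h3 h4).1, ((blowMap_eq_iff hc).1 h2).2⟩)
        · simp
      · rw [if_neg hpq]
        refine Finset.sum_eq_zero fun x _ => Finset.sum_eq_zero fun y _ => ?_
        rw [ite_eq_right_iff]
        rintro ⟨h1, h2, h3⟩
        rw [if_neg]
        rintro ⟨h4, h5⟩
        have h2 := (blowMap_eq_iff hc).1 h2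
        have h3 := (blowMap_eq_iff hc).1 h3
        refine hpq ⟨?_, by rw [← h2.2, ← h3.2, h5]⟩
        rw [← h2.1, ← h3.1]
        exact hE.map _ _ h1.symm h4
    change (if q.1 = p.1 then _ else _) + (if _ then _ else _) = _
    rw [← hD, ← hEE, ← Finset.sum_add_distrib]
    refine Finset.sum_congr rfl fun x _ => ?_
    rw [← Finset.sum_add_distrib]
    refine Finset.sum_congr rfl fun y _ => ?_
    simp only [meanderMatrix]
    by_cases hh : (L x.1 ↔ L y.1) ∧ blowMap hc x = p ∧ blowMap hc y = q
    · simp only [if_pos hh]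
    · simp only [if_neg hh, add_zero]

end BlowUp

/-! ### Blocks and arcs -/

/-- The index of the block that contains the vertex `x`; the number of blocks if `x` lies beyond the
last one. -/
def blockIndex : List ℕ → ℕ → ℕ
  | [], _ => 0
  | t :: ts, x => if x < t then 0 else blockIndex ts (x - t) + 1

theorem blockIndex_mono (l : List ℕ) {x y : ℕ} (h : x ≤ y) : blockIndex l x ≤ blockIndex l y := by
  induction l generalizing x y with
  | nil => exact le_rfl
  | cons t ts ih =>
    have := ih (Nat.sub_le_sub_right h t)
    simp only [blockIndex]
    split_ifs <;> omega

theorem isArc_cons (t : ℕ) (ts : List ℕ) (x y : ℕ) :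
    IsArc (t :: ts) x y ↔
      (x < y ∧ y < t ∧ x + y + 1 = t) ∨ (t ≤ x ∧ IsArc ts (x - t) (y - t)) := by
  constructor
  · rintro ⟨hxy, l₁, l₂, m, h, h1, h2, h3⟩
    cases l₁ with
    | nil =>
      simp only [List.nil_append, List.cons.injEq] at h
      simp only [List.sum_nil] at h1 h2 h3
      omega
    | cons s l₁ =>
      simp only [List.cons_append, List.cons.injEq] at h
      simp only [List.sum_cons] at h1 h2 h3
      obtain ⟨rfl, rfl⟩ := h
      exact .inr ⟨by omega, by omega, l₁, l₂, m, rfl, by omega, by omega, by omega⟩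
  · rintro (⟨h1, h2, h3⟩ | ⟨h, hxy, l₁, l₂, m, rfl, h1, h2, h3⟩)
    · exact ⟨h1, [], ts, t, rfl, by simp, by simpa using h2, by simpa using h3⟩
    · exact ⟨by omega, t :: l₁, l₂, m, rfl, by simp; omega, by simp; omega, by simp; omega⟩

theorem IsArc.lt {l : List ℕ} {x y : ℕ} (h : IsArc l x y) : x < y := h.1

/-- The support of the seaweed on the vertices of a meander: `u` is a row and `v` a column. -/
def Allowed (top bot : List ℕ) (u v : ℕ) : Prop :=
  blockIndex top u ≤ blockIndex top v ∧ blockIndex bot v ≤ blockIndex bot u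

/-- The edges of a meander, top edges from right to left and bottom edges from left to right. -/
def Edge (top bot : List ℕ) (u v : ℕ) : Prop := IsArc top v u ∨ IsArc bot u v

/-! ### The folding maps of the winding moves -/

/-- The folding map of a pure contraction, from the meander with first top block `a + 2b` and first
bottom block `b`: the first `b` vertices are reflected onto the last `b` vertices of the first top
block. The case `a = 0` is that of a block elimination. -/
def pureMap (N a b : ℕ) (hN : a + b ≤ N) (x : Fin (b + N)) : Fin N :=
  ⟨if (x : ℕ) < b then a + b - 1 - x else x - b, by split_ifs <;> omega⟩

theorem pureMap_fold (N a b : ℕ) (hN : a + b ≤ N) (as bs : List ℕ) :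
    Fold (fun u v : Fin (b + N) => Allowed ((a + 2 * b) :: as) (b :: bs) u v)
      (fun u v : Fin N => Allowed (a :: b :: as) bs u v)
      (fun x => (x : ℕ) < b) (fun x => (x : ℕ) < a + 2 * b) (pureMap N a b hN) := by
  have e : ∀ x, x - b - a - b = x - (a + 2 * b) := fun x => by omega
  constructor <;>
    simp only [pureMap, Allowed, blockIndex, Fin.ext_iff, Fin.forall_iff, Fin.exists_iff, ne_eq]
  · grind
  · intro p hp
    exact ⟨p + b, by omega, by grind⟩
  · grind
  · grind
  · grind
  · grind
  · intro x hx y hy h1 h2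
    by_cases h3 : x < b <;> by_cases h4 : y < b <;>
      simp only [h3, h4, if_true, if_false, e] at h2 ⊢ <;> grind
  · intro x hx y hy h1 h2 h3 h4
    have : y < a + b := by grind
    have : ¬ x < a + b := by grind
    exact ⟨by grind, ⟨a + 2 * b - 1 - x, by grind, by grind, by grind⟩, by grind⟩
  · intro x hx y hy h1 h2 h3
    exact ⟨a + 2 * b - 1 - y, by grind, by grind, by grind, by grind⟩
  · intro x hx y hy h1 h2 h3 h4
    have : a + b ≤ y := by grind
    exact ⟨fun _ => ⟨a + 2 * b - 1 - y, by grind⟩, fun _ => ⟨a + 2 * b - 1 - x, by grind⟩⟩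
  · intro x hx y hy r hr h1 h2 h3
    by_cases h4 : x < b
    · refine ⟨a + 2 * b - 1 - (r + b), ?_⟩
      grind
    · exact ⟨r + b, by grind⟩
  · intro p hp q hq h
    exact ⟨p + b, by grind, q + b, by grind⟩
  · intro x hx y hy h1 h2 h3
    exact .inl ⟨a + 2 * b - 1 - x, by grind⟩
  · intro x hx y hy z hz h1 h2 h3 h4 h5 h6
    have : y - b ≥ z - b := by
      have := h6 (a + 2 * b - 1 - z)
      grind
    have := blockIndex_mono bs this
    grind

theorem pureMap_edgeFold (N a b : ℕ) (hN : a + b ≤ N) (as bs : List ℕ) :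
    EdgeFold (fun u v : Fin (b + N) => Edge ((a + 2 * b) :: as) (b :: bs) u v)
      (fun u v : Fin N => Edge (a :: b :: as) bs u v)
      (fun x => (x : ℕ) < b) (pureMap N a b hN) := by
  have e : ∀ x, x - b - a - b = x - (a + 2 * b) := fun x => by omega
  have l : ∀ l x y, IsArc l x y → x < y := fun l x y h => h.lt
  constructor <;>
    simp only [pureMap, Edge, isArc_cons, Fin.ext_iff, Fin.forall_iff, Fin.exists_iff]
  · grind
  · grind
  · intro x hx y hy h1 h2
    by_cases h3 : x < b <;> by_cases h4 : y < b <;>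
      simp only [h3, h4, if_true, if_false, e] at h2 ⊢ <;> grind
  · intro p hp q hq h
    rcases h with (h | ⟨h1, h | h⟩) | h
    · exact ⟨p + b, by grind, q + b, by grind⟩
    · exact ⟨a + b - 1 - p, by grind, a + b - 1 - q, by grind⟩
    · have := l _ _ _ h.2
      exact ⟨p + b, by grind, q + b, by grind⟩
    · have := l _ _ _ h
      exact ⟨p + b, by grind, q + b, by grind⟩
  · grind

/-- The folding map of a rotation contraction, from the meander with first top block `2a - b` and
first bottom block `a`: the first `a` vertices are reflected, and the others are shifted, so that
the vertices `b, …, a - 1` are covered twice. -/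
def rotMap (N a b : ℕ) (hN : a ≤ N) (hb : b ≤ a) (x : Fin (a - b + N)) : Fin N :=
  ⟨if (x : ℕ) < a then a - 1 - x else x - (a - b), by split_ifs <;> omega⟩

theorem rotMap_fold (N a b : ℕ) (hN : a ≤ N) (hb : b ≤ a) (as bs : List ℕ) :
    Fold (fun u v : Fin (a - b + N) => Allowed ((2 * a - b) :: as) (a :: bs) u v)
      (fun u v : Fin N => Allowed (a :: as) (b :: bs) u v)
      (fun x => (x : ℕ) < a) (fun x => (x : ℕ) < 2 * a - b) (rotMap N a b hN hb) := by
  have e : ∀ x, x - (a - b) - a = x - (2 * a - b) := fun x => by omega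
  have e' : ∀ x, ¬ x < a → x - (a - b) - b = x - a := fun x => by omega
  constructor <;>
    simp only [rotMap, Allowed, blockIndex, Fin.ext_iff, Fin.forall_iff, Fin.exists_iff, ne_eq]
  · grind
  · intro p hp
    by_cases h : p < b
    · exact ⟨a - 1 - p, by omega, by grind⟩
    · exact ⟨p + (a - b), by omega, by grind⟩
  · grind
  · grind
  · grind
  · grind
  · intro x hx y hy h1 h2
    by_cases h3 : x < a <;> by_cases h4 : y < a <;>
      simp only [h3, h4, if_true, if_false, e, not_false_eq_true, e'] at h2 ⊢ <;> grind
  · intro x hx y hy h1 h2 h3 h4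
    exfalso
    simp only [h1, h2, if_false, e, not_false_eq_true, e'] at h3 h4
    grind
  · intro x hx y hy h1 h2 h3
    exact ⟨2 * a - b - 1 - y, by grind, by grind, by grind, by grind⟩
  · intro x hx y hy h1 h2 h3 h4
    have : x < a - b := by grind
    exact ⟨fun _ => ⟨2 * a - b - 1 - y, by grind⟩, fun _ => ⟨2 * a - b - 1 - x, by grind⟩⟩
  · intro x hx y hy r hr h1 h2 h3
    by_cases h4 : x < a
    · refine ⟨a - 1 - r, ?_⟩
      grind
    · exact ⟨r + (a - b), by grind⟩
  · intro p hp q hq h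
    by_cases h1 : b ≤ p ∧ b ≤ q
    · exact ⟨p + (a - b), by grind, q + (a - b), by grind⟩
    · exact ⟨a - 1 - p, by grind, a - 1 - q, by grind⟩
  · intro x hx y hy h1 h2 h3
    exact .inr ⟨2 * a - b - 1 - y, by grind⟩
  · intro x hx y hy z hz h1 h2 h3 h4 h5 h6
    have := h6 (2 * a - b - 1 - z)
    grind

theorem rotMap_edgeFold (N a b : ℕ) (hN : a ≤ N) (hb : b ≤ a) (as bs : List ℕ) :
    EdgeFold (fun u v : Fin (a - b + N) => Edge ((2 * a - b) :: as) (a :: bs) u v)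
      (fun u v : Fin N => Edge (a :: as) (b :: bs) u v)
      (fun x => (x : ℕ) < a) (rotMap N a b hN hb) := by
  have e : ∀ x, x - (a - b) - a = x - (2 * a - b) := fun x => by omega
  have e' : ∀ x, ¬ x < a → x - (a - b) - b = x - a := fun x => by omega
  have l : ∀ l x y, IsArc l x y → x < y := fun l x y h => h.lt
  constructor <;>
    simp only [rotMap, Edge, isArc_cons, Fin.ext_iff, Fin.forall_iff, Fin.exists_iff]
  · grind
  · grind
  · intro x hx y hy h1 h2
    by_cases h3 : x < a
    · have h4 := h1.1 h3
      simp only [h3, h4, if_true]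
      rcases h2 with (h | h) | h | h
      · exact .inr (.inl (by omega))
      · omega
      · exact .inl (.inl (by omega))
      · omega
    · have h4 : ¬y < a := fun h => h3 (h1.2 h)
      simp only [h3, h4, if_false, e, not_false_eq_true, e']
      grind
  · intro p hp q hq h
    rcases h with (h | h) | (h | h)
    · exact ⟨a - 1 - p, by grind, a - 1 - q, by grind⟩
    · have := l _ _ _ h.2
      have e2 : ∀ q, q + (a - b) - (2 * a - b) = q - a := fun q => by omega
      refine ⟨p + (a - b), by grind, q + (a - b), by grind, by grind, by grind, by grind, ?_⟩
      rw [e2, e2]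
      exact .inl (.inr ⟨by omega, h.2⟩)
    · exact ⟨a - 1 - p, by omega, a - 1 - q, by omega, by omega, by grind, by grind,
        .inl (.inl (by omega))⟩
    · have := l _ _ _ h.2
      have e2 : ∀ q, b ≤ q → q + (a - b) - a = q - b := fun q _ => by omega
      refine ⟨p + (a - b), by grind, q + (a - b), by grind, by grind, by grind, by grind, ?_⟩
      rw [e2 p (by omega), e2 q (by omega)]
      exact .inr (.inr ⟨by omega, h.2⟩)
  · grind

/-! ### Winding up preserves the structure of the component meander -/

theorem edge_swap (top bot : List ℕ) (u v : ℕ) : Edge bot top u v ↔ Edge top bot v u := or_comm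

theorem allowed_swap (top bot : List ℕ) (u v : ℕ) : Allowed bot top u v ↔ Allowed top bot v u :=
  and_comm

/-- The dimension of the kernel of the form on `𝔤𝔩(c)` that is attached to the functional with
coefficients `G`. -/
noncomputable def glRadDim (c : ℕ) (G : ℕ → ℕ → ℂ) : ℕ :=
  radDim (fun _ _ : Fin c => True) (Matrix.of fun x y => G y x)

theorem glRadDim_transpose (c : ℕ) (G : ℕ → ℕ → ℂ) :
    glRadDim c (fun p q => G q p) = glRadDim c G :=
  radDim_transpose (fun _ _ => Iff.rfl) fun _ _ => rfl

/-- What is needed about the component meander with the given blocks, in which the vertex `v` lies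
on the path with index `lab v` and stands for `cs[lab v]` vertices: the labels are the connected
components, the graph is bipartite, and the radical of the form attached to the component meander
has the same dimension as that of the direct sum of the components, for all coefficients and all
positive weights. -/
structure CoreData (N : ℕ) (top bot : List ℕ) (lab : Fin N → ℕ) (cs : List ℕ) : Prop where
  label_lt : ∀ v, lab v < cs.length
  label_edge : ∀ u v : Fin N, Edge top bot u v → lab u = lab v
  colouring : ∃ col : Fin N → Bool, ∀ u v : Fin N, Edge top bot u v → col u ≠ col v
  connected : ∀ u v : Fin N, lab u = lab v →
    Relation.EqvGen (fun u v : Fin N => Edge top bot u v) u v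
  radDim_eq : ∀ w : Fin N → ℕ, (∀ v, 0 < w v) → ∀ F : ℕ → ℕ → ℕ → ℂ,
    radDim (fun x y : BlowUp (fun v => cs.getD (lab v) 0) => Allowed top bot x.1 y.1)
      (meanderMatrix _ (fun u v : Fin N => Edge top bot u v) lab w F) =
    ∑ i ∈ Finset.range cs.length, glRadDim (cs.getD i 0) (F i)

theorem meanderMatrix_congr {V V' : Type*} {c : V → ℕ} {c' : V' → ℕ} {E : V → V → Prop}
    {E' : V' → V' → Prop} {lab w : V → ℕ} {lab' w' : V' → ℕ} {F F' : ℕ → ℕ → ℕ → ℂ}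
    {x y : BlowUp c} {x' y' : BlowUp c'} (h₁ : y.1 = x.1 ↔ y'.1 = x'.1)
    (h₂ : y.1 = x.1 → (w x.1 : ℂ) * F (lab x.1) y.2 x.2 = w' x'.1 * F' (lab' x'.1) y'.2 x'.2)
    (h₃ : (E y.1 x.1 ∧ (y.2 : ℕ) = x.2) ↔ (E' y'.1 x'.1 ∧ (y'.2 : ℕ) = x'.2)) :
    meanderMatrix c E lab w F x y = meanderMatrix c' E' lab' w' F' x' y' := by
  rw [meanderMatrix, meanderMatrix]
  congr 1
  · by_cases h : y.1 = x.1
    · rw [if_pos h, if_pos (h₁.1 h), h₂ h]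
    · rw [if_neg h, if_neg fun h' => h (h₁.2 h')]
  · by_cases h : E y.1 x.1 ∧ (y.2 : ℕ) = x.2
    · rw [if_pos h, if_pos (h₃.1 h)]
    · rw [if_neg h, if_neg fun h' => h (h₃.2 h')]

namespace CoreData

theorem cast {N N' : ℕ} {top bot : List ℕ} {lab : Fin N → ℕ} {cs : List ℕ}
    (h : CoreData N top bot lab cs) (hN : N' = N) {lab' : Fin N' → ℕ}
    (hlab : ∀ v, lab' v = lab (Fin.cast hN v)) : CoreData N' top bot lab' cs := by
  subst hN
  obtain rfl : lab' = lab := funext hlab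
  exact h

theorem nil : CoreData 0 [] [] Fin.elim0 [] where
  label_lt v := v.elim0
  label_edge v := v.elim0
  colouring := ⟨Fin.elim0, fun v => v.elim0⟩
  connected v := v.elim0
  radDim_eq w hw F := by
    rw [List.length_nil, Finset.range_zero, Finset.sum_empty]
    have : IsEmpty (BlowUp fun v : Fin 0 => ([] : List ℕ).getD (Fin.elim0 v) 0) :=
      ⟨fun x => x.1.elim0⟩
    exact Module.finrank_zero_of_subsingleton

/-- Exchanging the rows transposes the seaweed. -/
theorem flip {N : ℕ} {top bot : List ℕ} {lab : Fin N → ℕ} {cs : List ℕ}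
    (h : CoreData N top bot lab cs) : CoreData N bot top lab cs where
  label_lt := h.label_lt
  label_edge u v huv := (h.label_edge v u ((edge_swap _ _ _ _).1 huv)).symm
  colouring := by
    obtain ⟨col, hcol⟩ := h.colouring
    exact ⟨col, fun u v huv => (hcol v u ((edge_swap _ _ _ _).1 huv)).symm⟩
  connected u v huv := by
    have huv' := h.connected u v huv
    clear huv
    induction huv' with
    | rel x y hxy => exact .symm _ _ (.rel _ _ ((edge_swap _ _ _ _).2 hxy))
    | refl x => exact .refl x
    | symm x y _ ih => exact .symm _ _ ih
    | trans x y z _ _ ih₁ ih₂ => exact .trans _ _ _ ih₁ ih₂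
  radDim_eq w hw F := by
    rw [← Finset.sum_congr rfl fun i _ => glRadDim_transpose (cs.getD i 0) (F i),
      ← h.radDim_eq w hw fun i p q => F i q p]
    refine radDim_transpose (fun x y => allowed_swap _ _ _ _) fun x y => ?_
    refine meanderMatrix_congr eq_comm (fun hxy => ?_) (and_congr (edge_swap _ _ _ _).symm eq_comm)
    change (w y.1 : ℂ) * F (lab y.1) (y.2 : ℕ) (x.2 : ℕ) = w x.1 * F (lab x.1) (y.2 : ℕ) (x.2 : ℕ)
    generalize (x.2 : ℕ) = s
    rw [hxy]

/-- Reversing a contraction. Each fibre of the folding map is a single vertex or a pair of partners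
joined by a new edge, so the paths are only extended. -/
theorem of_fold {N N' : ℕ} {top bot top' bot' : List ℕ} {lab : Fin N → ℕ} {lab' : Fin N' → ℕ}
    {cs : List ℕ} (h : CoreData N' top' bot' lab' cs) {L T : Fin N → Prop} {ρ : Fin N → Fin N'}
    (hf : Fold (fun u v : Fin N => Allowed top bot u v) (fun u v : Fin N' => Allowed top' bot' u v)
      L T ρ)
    (he : EdgeFold (fun u v : Fin N => Edge top bot u v) (fun u v : Fin N' => Edge top' bot' u v)
      L ρ)
    (hlab : ∀ v, lab' (ρ v) = lab v) : CoreData N top bot lab cs where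
  label_lt v := hlab v ▸ h.label_lt (ρ v)
  label_edge u v huv := by
    rw [← hlab, ← hlab]
    by_cases hs : L u ↔ L v
    · exact h.label_edge _ _ (he.map u v hs huv)
    · by_cases hu : L u
      · exact absurd huv (he.left_right u v hu (by tauto))
      · rw [(he.right_left v u (by tauto) hu).1 huv]
  colouring := by
    classical
    obtain ⟨col, hcol⟩ := h.colouring
    -- The new edges join the left part to its complement, so the colours of the left part change.
    refine ⟨fun v => if L v then !col (ρ v) else col (ρ v), fun u v huv => ?_⟩
    by_cases hs : L u ↔ L v
    · have := hcol _ _ (he.map u v hs huv)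
      by_cases hu : L u
      · simpa [hu, hs.1 hu] using this
      · have hv : ¬L v := fun hv => hu (hs.2 hv)
        simpa [hu, hv] using this
    · by_cases hu : L u
      · exact absurd huv (he.left_right u v hu (by tauto))
      · have hv : L v := by tauto
        simp [hu, hv, (he.right_left v u hv hu).1 huv]
  connected := by
    have fibre : ∀ x y, ρ x = ρ y → Relation.EqvGen (fun u v : Fin N => Edge top bot u v) x y := by
      intro x y hxy
      by_cases hs : L x ↔ L y
      · rw [hf.inj x y hs hxy]
        exact .refl y
      · by_cases hx : L x
        · exact .symm _ _ (.rel _ _ ((he.right_left x y hx (by tauto)).2 hxy))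
        · exact .rel _ _ ((he.right_left y x (by tauto) hx).2 hxy.symm)
    have key : ∀ p q, Relation.EqvGen (fun u v : Fin N' => Edge top' bot' u v) p q →
        ∀ x y, ρ x = p → ρ y = q →
          Relation.EqvGen (fun u v : Fin N => Edge top bot u v) x y := by
      intro p q hpq
      induction hpq with
      | rel p q hpq =>
        intro x y hx hy
        obtain ⟨x', y', -, hx', hy', hxy⟩ := he.lift p q hpq
        exact .trans _ _ _ (fibre x x' (hx.trans hx'.symm))
          (.trans _ _ _ (.rel _ _ hxy) (fibre y' y (hy'.trans hy.symm)))
      | refl p => exact fun x y hx hy => fibre x y (hx.trans hy.symm)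
      | symm p q _ ih => exact fun x y hx hy => .symm _ _ (ih y x hy hx)
      | trans p q r _ _ ih₁ ih₂ =>
        intro x y hx hy
        obtain ⟨z, hz⟩ := hf.surj q
        exact .trans _ _ _ (ih₁ x z hx hz) (ih₂ z y hz hy)
    intro u v huv
    exact key _ _ (h.connected (ρ u) (ρ v) (by rw [hlab, hlab, huv])) u v rfl rfl
  radDim_eq w hw F := by
    rw [radDim_meanderMatrix_fold hf he (c' := fun v => cs.getD (lab' v) 0)
      (fun v => by rw [hlab]) hlab w F]
    refine h.radDim_eq _ (fun p => ?_) F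
    obtain ⟨x, hx⟩ := hf.surj p
    refine Finset.sum_pos' (fun v _ => Nat.zero_le _) ⟨x, Finset.mem_univ x, ?_⟩
    rw [if_pos hx]
    exact hw x

theorem edge_succ (top bot : List ℕ) (u v : ℕ) :
    Edge (1 :: top) (1 :: bot) (u + 1) (v + 1) ↔ Edge top bot u v := by
  simp only [Edge, isArc_cons, Nat.add_sub_cancel]
  constructor
  · rintro ((h | h) | h | h)
    · omega
    · exact .inl h.2
    · omega
    · exact .inr h.2
  · rintro (h | h)
    · exact .inl (.inr ⟨by omega, h⟩)
    · exact .inr (.inr ⟨by omega, h⟩)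

theorem not_edge_zero (top bot : List ℕ) (u : ℕ) :
    ¬Edge (1 :: top) (1 :: bot) u 0 ∧ ¬Edge (1 :: top) (1 :: bot) 0 u := by
  simp only [Edge, isArc_cons]
  constructor
  · rintro ((h | h) | h | h)
    · omega
    · omega
    · omega
    · have := h.2.lt
      omega
  · rintro ((h | h) | h | h)
    · omega
    · have := h.2.lt
      omega
    · omega
    · omega

/-- Reversing a component deletion adds an isolated vertex on the left, and with it a direct summand
`𝔤𝔩(c)`. -/
theorem deletion {N : ℕ} {top bot : List ℕ} {lab : Fin N → ℕ} {cs : List ℕ}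
    (h : CoreData N top bot lab cs) (c : ℕ) :
    CoreData (N + 1) (1 :: top) (1 :: bot) (Fin.cons 0 fun v => lab v + 1) (c :: cs) where
  label_lt v := by
    refine Fin.cases ?_ (fun v => ?_) v
    · simp
    · simpa using h.label_lt v
  label_edge u v := by
    refine Fin.cases (fun h0 => ?_) (fun u => ?_) u
    · exact absurd h0 (not_edge_zero _ _ _).2
    · refine Fin.cases (fun h0 => ?_) (fun v huv => ?_) v
      · exact absurd h0 (not_edge_zero _ _ _).1
      · simpa using h.label_edge u v ((edge_succ _ _ _ _).1 huv)
  colouring := by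
    obtain ⟨col, hcol⟩ := h.colouring
    refine ⟨Fin.cons true col, fun u v => ?_⟩
    refine Fin.cases (fun h0 => ?_) (fun u => ?_) u
    · exact absurd h0 (not_edge_zero _ _ _).2
    · refine Fin.cases (fun h0 => ?_) (fun v huv => ?_) v
      · exact absurd h0 (not_edge_zero _ _ _).1
      · simpa using hcol u v ((edge_succ _ _ _ _).1 huv)
  connected u v := by
    refine Fin.cases ?_ (fun u => ?_) u <;> refine Fin.cases ?_ (fun v => ?_) v
    · exact fun _ => .refl 0
    · exact fun h0 => absurd h0 (by simp)
    · exact fun h0 => absurd h0 (by simp)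
    · intro huv
      have huv' := h.connected u v (by simpa using huv)
      clear huv
      induction huv' with
      | rel x y hxy => exact .rel _ _ ((edge_succ _ _ _ _).2 hxy)
      | refl x => exact .refl _
      | symm x y _ ih => exact .symm _ _ ih
      | trans x y z _ _ ih₁ ih₂ => exact .trans _ _ _ ih₁ ih₂
  radDim_eq w hw F := by
    let cc : Fin (N + 1) → ℕ := fun v =>
      (c :: cs).getD ((Fin.cons 0 fun v => lab v + 1 : Fin (N + 1) → ℕ) v) 0
    let e' : Fin c ⊕ BlowUp (fun v => cs.getD (lab v) 0) → BlowUp cc :=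
      Sum.elim (fun s => ⟨0, s⟩) fun x => ⟨x.1.succ, x.2⟩
    have he' : Function.Bijective e' := by
      constructor
      · rintro (s | ⟨x, s⟩) (r | ⟨y, r⟩) hxy
        · have := (blowUp_ext.1 hxy).2
          exact congrArg _ (Fin.ext this)
        · exact absurd (blowUp_ext.1 hxy).1 (Fin.succ_ne_zero _).symm
        · exact absurd (blowUp_ext.1 hxy).1 (Fin.succ_ne_zero _)
        · have := blowUp_ext.1 hxy
          exact congrArg _ (blowUp_ext.2 ⟨Fin.succ_injective _ this.1, this.2⟩)
      · rintro ⟨v, s⟩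
        revert s
        refine Fin.cases (fun s => ?_) (fun v s => ?_) v
        · exact ⟨.inl s, rfl⟩
        · exact ⟨.inr ⟨v, s⟩, rfl⟩
    let e := Equiv.ofBijective e' he'
    rw [← radDim_reindex e (P := fun x y => Allowed (1 :: top) (1 :: bot) (e x).1 (e y).1)
      (M := Matrix.submatrix (meanderMatrix cc (fun u v : Fin (N + 1) =>
        Edge (1 :: top) (1 :: bot) u v) _ w F) e e) (fun _ _ => Iff.rfl) (fun _ _ => rfl),
      radDim_sum (P₁ := fun _ _ : Fin c => True)
        (P₂ := fun x y : BlowUp (fun v => cs.getD (lab v) 0) => Allowed top bot x.1 y.1),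
      List.length_cons, Finset.sum_range_succ', add_comm]
    · congr 1
      · refine Eq.trans ?_
          (h.radDim_eq (fun v => w v.succ) (fun v => hw _) (fun i => F (i + 1)))
        congr 1
        ext x y
        exact meanderMatrix_congr (E := fun u v : Fin (N + 1) => Edge (1 :: top) (1 :: bot) u v)
          (E' := fun u v : Fin N => Edge top bot u v)
          (x := (⟨x.1.succ, x.2⟩ : BlowUp cc)) (y := ⟨y.1.succ, y.2⟩)
          Fin.succ_inj (fun _ => rfl) (and_congr (edge_succ _ _ _ _) Iff.rfl)
      · refine Eq.trans ?_ (radDim_smul (c := (w 0 : ℂ)) (by exact_mod_cast (hw 0).ne'))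
        congr 1
        ext x y
        have : meanderMatrix cc (fun u v : Fin (N + 1) => Edge (1 :: top) (1 :: bot) u v)
            (Fin.cons 0 fun v => lab v + 1) w F ⟨0, x⟩ ⟨0, y⟩ = (w 0 : ℂ) * F 0 y x := by
          rw [meanderMatrix, if_pos rfl, if_neg fun h0 => (not_edge_zero _ _ _).1 h0.1, add_zero]
          rfl
        exact this
    · exact fun x y => iff_of_true ⟨le_rfl, le_rfl⟩ trivial
    · intro x y
      change Allowed (1 :: top) (1 :: bot) (x.1 + 1) (y.1 + 1) ↔ _
      simp [Allowed, blockIndex]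
    · intro x y
      change ¬Allowed (1 :: top) (1 :: bot) 0 (y.1 + 1)
      simp [Allowed, blockIndex]
    · intro x y
      change ¬Allowed (1 :: top) (1 :: bot) (x.1 + 1) 0
      simp [Allowed, blockIndex]

end CoreData

/-- `Z`, divided into consecutive blocks of the given lengths, has the given block sums. -/
def BlockSums : List ℕ → List ℕ → List ℕ → Prop
  | Z, [], [] => Z = []
  | Z, t :: ts, a :: as => t ≤ Z.length ∧ (Z.take t).sum = a ∧ BlockSums (Z.drop t) ts as
  | _, _, _ => False

namespace BlockSums

theorem zero {Z ts as : List ℕ} (h : BlockSums Z ts as) : BlockSums Z (0 :: ts) (0 :: as) :=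
  ⟨Nat.zero_le _, by simp, by simpa using h⟩

theorem merge {Z ts as : List ℕ} {s t a b : ℕ} (h : BlockSums Z (s :: t :: ts) (a :: b :: as)) :
    BlockSums Z ((s + t) :: ts) ((a + b) :: as) := by
  obtain ⟨h1, h2, h3, h4, h5⟩ := h
  rw [List.length_drop] at h3
  refine ⟨by omega, ?_, by rwa [List.drop_drop] at h5⟩
  rw [List.take_add, List.sum_append, h2, h4]

theorem append {Z ts as : List ℕ} {t a : ℕ} (h : BlockSums Z (t :: ts) (a :: as)) (W : List ℕ) :
    BlockSums (W ++ Z) ((W.length + t) :: ts) ((W.sum + a) :: as) := by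
  obtain ⟨h1, h2, h3⟩ := h
  refine ⟨by simpa using h1, ?_, ?_⟩
  · rw [List.take_length_add_append, List.sum_append, h2]
  · rwa [List.drop_length_add_append]

theorem eq_cons {Z ts as : List ℕ} {a : ℕ} (h : BlockSums Z ts (a :: as)) :
    ∃ t ts', ts = t :: ts' := by
  cases ts with
  | nil => exact h.elim
  | cons t ts => exact ⟨t, ts, rfl⟩

end BlockSums

namespace CoreData

/-- An empty first block changes nothing. -/
theorem zero {N : ℕ} {top bot : List ℕ} {lab : Fin N → ℕ} {cs : List ℕ}
    (h : CoreData N top bot lab cs) : CoreData N (0 :: top) bot lab cs := by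
  have h1 : Edge (0 :: top) bot = Edge top bot := by
    funext u v
    simp [Edge, isArc_cons]
  have h2 : Allowed (0 :: top) bot = Allowed top bot := by
    funext u v
    simp [Allowed, blockIndex]
  constructor
  · exact h.label_lt
  · rw [h1]
    exact h.label_edge
  · rw [h1]
    exact h.colouring
  · rw [h1]
    exact h.connected
  · rw [h1, h2]
    exact h.radDim_eq

theorem pure {l top bot cs : List ℕ} {a b : ℕ} (hab : a + b ≤ l.length)
    (h : CoreData l.length (a :: b :: top) bot l.get cs) :
    CoreData (((l.drop a).take b).reverse ++ l).length ((a + 2 * b) :: top) (b :: bot)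
      (((l.drop a).take b).reverse ++ l).get cs := by
  have hlen : (((l.drop a).take b).reverse ++ l).length = b + l.length := by
    simp
    omega
  refine (h.of_fold (pureMap_fold l.length a b hab top bot)
    (pureMap_edgeFold l.length a b hab top bot)
    (lab := fun v => l.get (pureMap l.length a b hab v)) fun v => rfl).cast hlen fun v => ?_
  have hv := v.2
  simp only [List.get_eq_getElem, pureMap, Fin.val_cast]
  grind

theorem rotation {l top bot cs : List ℕ} {a b : ℕ} (ha : a ≤ l.length) (hb : b ≤ a)
    (h : CoreData l.length (a :: top) (b :: bot) l.get cs) :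
    CoreData ((l.take a).reverse.take (a - b) ++ l).length ((2 * a - b) :: top) (a :: bot)
      ((l.take a).reverse.take (a - b) ++ l).get cs := by
  have hlen : ((l.take a).reverse.take (a - b) ++ l).length = a - b + l.length := by
    simp
    omega
  refine (h.of_fold (rotMap_fold l.length a b ha hb top bot)
    (rotMap_edgeFold l.length a b ha hb top bot)
    (lab := fun v => l.get (rotMap l.length a b ha hb v)) fun v => rfl).cast hlen fun v => ?_
  have hv := v.2
  -- The first bottom block of the smaller meander is its own mirror image, so that its vertices
  -- have the labels of their mirror images.
  have hsymm : ∀ p q : ℕ, ∀ hp : p < l.length, ∀ hq : q < l.length, p + q + 1 = b →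
      l[p] = l[q] := by
    have aux : ∀ p q : ℕ, ∀ hp : p < l.length, ∀ hq : q < l.length, p + q + 1 = b → p < q →
        l[p] = l[q] := fun p q hp hq hpq hlt =>
      h.label_edge ⟨p, hp⟩ ⟨q, hq⟩ (.inr ((isArc_cons _ _ _ _).2
        (.inl ⟨hlt, by change q < b; omega, hpq⟩)))
    intro p q hp hq hpq
    rcases lt_trichotomy p q with hlt | rfl | hlt
    · exact aux p q hp hq hpq hlt
    · rfl
    · exact (aux q p hq hp (by omega) hlt).symm
  simp only [List.get_eq_getElem, rotMap, Fin.val_cast]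
  by_cases h1 : (v : ℕ) < a - b
  · grind
  · by_cases h2 : (v : ℕ) < a
    · rw [List.getElem_append_right (by simp; omega)]
      simp only [h2, if_true]
      refine hsymm _ _ _ _ ?_
      simp
      omega
    · grind

end CoreData

/-- The meander `m` is the component meander of the type `as / bs`, with components of the sizes
`cs`. -/
structure IsComponentMeander (m : LabelledMeander) (cs as bs : List ℕ) : Prop where
  top_sums : BlockSums (m.label.map fun i => cs.getD i 0) m.top as
  bottom_sums : BlockSums (m.label.map fun i => cs.getD i 0) m.bottom bs
  core : CoreData m.label.length m.top m.bottom m.label.get cs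

namespace IsComponentMeander

theorem pure {a b : ℕ} {top bot l cs as bs : List ℕ} {A B : ℕ}
    (h : IsComponentMeander ⟨a :: b :: top, bot, l⟩ cs (A :: B :: as) bs) :
    IsComponentMeander ⟨(a + 2 * b) :: top, b :: bot, ((l.drop a).take b).reverse ++ l⟩ cs
      ((A + 2 * B) :: as) (B :: bs) := by
  obtain ⟨h1, h2, h3⟩ := h
  dsimp only at h1 h2 h3
  have hlen := h1.merge.1
  rw [List.length_map] at hlen
  set f : ℕ → ℕ := fun i => cs.getD i 0
  have hW : (((l.drop a).take b).reverse.map f).sum = B := by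
    rw [List.map_reverse, List.sum_reverse, ← h1.2.2.2.1, List.map_take, List.map_drop]
  have hWl : (((l.drop a).take b).reverse.map f).length = b := by
    simp
    omega
  refine ⟨?_, ?_, h3.pure hlen⟩
  · have := h1.merge.append (((l.drop a).take b).reverse.map f)
    rw [hW, hWl, ← List.map_append] at this
    convert this using 2 <;> ring
  · have := h2.zero.append (((l.drop a).take b).reverse.map f)
    rwa [hW, hWl, ← List.map_append] at this

theorem rotation {a b : ℕ} {top bot l cs as bs : List ℕ} {A B : ℕ} (hAB : B < A)
    (h : IsComponentMeander ⟨a :: top, b :: bot, l⟩ cs (A :: as) (B :: bs)) :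
    IsComponentMeander ⟨(2 * a - b) :: top, a :: bot, (l.take a).reverse.take (a - b) ++ l⟩ cs
      ((2 * A - B) :: as) (A :: bs) := by
  obtain ⟨h1, h2, h3⟩ := h
  dsimp only at h1 h2 h3
  have hlen := h1.1
  rw [List.length_map] at hlen
  set f : ℕ → ℕ := fun i => cs.getD i 0
  -- The first `b` and the first `a` vertices have total sizes `B < A`, whence `b ≤ a`.
  have hba : b ≤ a := by
    by_contra hlt
    have e : b = a + (b - a) := by omega
    have := h2.2.1
    rw [e, List.take_add, List.sum_append, h1.2.1] at this
    omega
  have hWl : (((l.take a).reverse.take (a - b)).map f).length = a - b := by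
    simp
    omega
  have hW : (((l.take a).reverse.take (a - b)).map f).sum = A - B := by
    have e1 : (l.take a).reverse.take (a - b) = ((l.take a).drop b).reverse := by
      rw [List.take_reverse]
      congr 2
      simp
      omega
    have e2 : ((l.map f).take a).take b = (l.map f).take b := by
      rw [List.take_take, min_eq_left hba]
    have := List.sum_take_add_sum_drop ((l.map f).take a) b
    rw [e2, h1.2.1, h2.2.1] at this
    rw [e1, List.map_reverse, List.sum_reverse, List.map_drop, List.map_take]
    omega
  refine ⟨?_, ?_, h3.rotation hlen hba⟩
  · have := h1.append (((l.take a).reverse.take (a - b)).map f)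
    rw [hW, hWl, ← List.map_append] at this
    convert this using 2 <;> omega
  · have := h2.append (((l.take a).reverse.take (a - b)).map f)
    rw [hW, hWl, ← List.map_append] at this
    convert this using 2 <;> omega

theorem deletion {top bot l cs as bs : List ℕ} (h : IsComponentMeander ⟨top, bot, l⟩ cs as bs)
    (c : ℕ) :
    IsComponentMeander ⟨1 :: top, 1 :: bot, List.replicate 1 0 ++ l.map (· + 1)⟩ (c :: cs)
      (c :: as) (c :: bs) := by
  obtain ⟨h1, h2, h3⟩ := h
  dsimp only at h1 h2 h3
  have e : (List.replicate 1 0 ++ l.map (· + 1)).map (fun i => (c :: cs).getD i 0) =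
      c :: l.map fun i => cs.getD i 0 := by
    simp
  refine ⟨?_, ?_, ?_⟩
  · dsimp only
    rw [e]
    exact ⟨by simp, by simp, h1⟩
  · dsimp only
    rw [e]
    exact ⟨by simp, by simp, h2⟩
  · refine (h3.deletion c).cast (by simp) ?_
    rintro ⟨v, hv⟩
    cases v with
    | zero => rfl
    | succ v => simp [Fin.cons]

theorem flip {top bot l cs as bs : List ℕ} (h : IsComponentMeander ⟨top, bot, l⟩ cs as bs) :
    IsComponentMeander ⟨bot, top, l⟩ cs bs as :=
  ⟨h.bottom_sums, h.top_sums, h.core.flip⟩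

end IsComponentMeander

theorem isComponentMeander_windUp (as bs : List ℕ) (ha : ∀ x ∈ as, 0 < x) (hb : ∀ x ∈ bs, 0 < x)
    (hs : as.sum = bs.sum) :
    IsComponentMeander (windUp ((signature as bs).map Move.toUnit))
      (deletionSizes (signature as bs)) as bs := by
  induction as, bs using signature.induct with
  | case1 as b bs ih =>
    rw [signature, if_pos rfl]
    have := ih (fun x hx => ha x (List.mem_cons_of_mem _ hx))
      (fun x hx => hb x (List.mem_cons_of_mem _ hx)) (by simpa using hs)
    exact this.deletion b
  | case2 a as b bs h1 h2 ih =>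
    rw [signature, if_neg h1, if_pos h2]
    exact (ih hb ha hs.symm).flip
  | case3 a as bs h1 h2 => exact absurd (hb 0 List.mem_cons_self) (lt_irrefl 0)
  | case4 as b bs h1 h2 h3 ih =>
    rw [signature, if_neg h2, if_neg h3, if_neg h1, if_pos rfl]
    have := ih (fun x hx => by
        rcases List.mem_cons.1 hx with rfl | hx
        · omega
        · exact ha x (List.mem_cons_of_mem _ hx))
      (fun x hx => hb x (List.mem_cons_of_mem _ hx)) (by simp at hs ⊢; omega)
    simp only [List.map_cons, Move.toUnit, windUp, deletionSizes]
    generalize windUp ((signature (b :: as) bs).map Move.toUnit) = m at this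
    obtain ⟨top, bot, l⟩ := m
    obtain ⟨t, top, rfl⟩ := this.top_sums.eq_cons
    -- A block elimination is a pure contraction with an empty block.
    have h0 : IsComponentMeander ⟨0 :: t :: top, bot, l⟩ _ (0 :: b :: as) bs :=
      ⟨this.top_sums.zero, this.bottom_sums, this.core.zero⟩
    simpa using h0.pure
  | case5 a as b bs h1 h2 h3 h4 h5 ih =>
    rw [signature, if_neg h1, if_neg h2, if_neg h3, if_neg h4, if_pos h5]
    have := ih (fun x hx => by
        rcases List.mem_cons.1 hx with rfl | hx
        · omega
        · exact ha x (List.mem_cons_of_mem _ hx))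
      (fun x hx => by
        rcases List.mem_cons.1 hx with rfl | hx
        · omega
        · exact hb x (List.mem_cons_of_mem _ hx)) (by simp at hs ⊢; omega)
    simp only [List.map_cons, Move.toUnit, windUp, deletionSizes]
    generalize windUp ((signature (b :: as) ((2 * b - a) :: bs)).map Move.toUnit) = m at this
    obtain ⟨top, bot, l⟩ := m
    obtain ⟨t, top, rfl⟩ := this.top_sums.eq_cons
    obtain ⟨s, bot, rfl⟩ := this.bottom_sums.eq_cons
    have h0 := this.rotation (by omega)
    have e : 2 * b - (2 * b - a) = a := by omega
    rwa [e] at h0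
  | case6 a as b bs h1 h2 h3 h4 h5 ih =>
    rw [signature, if_neg h1, if_neg h2, if_neg h3, if_neg h4, if_neg h5]
    have := ih (fun x hx => by
        rcases List.mem_cons.1 hx with rfl | hx
        · omega
        · rcases List.mem_cons.1 hx with rfl | hx
          · omega
          · exact ha x (List.mem_cons_of_mem _ hx))
      (fun x hx => hb x (List.mem_cons_of_mem _ hx)) (by simp at hs ⊢; omega)
    simp only [List.map_cons, Move.toUnit, windUp, deletionSizes]
    generalize windUp ((signature ((a - 2 * b) :: b :: as) bs).map Move.toUnit) = m at this
    obtain ⟨top, bot, l⟩ := m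
    obtain ⟨t, top, rfl⟩ := this.top_sums.eq_cons
    obtain ⟨s, top, rfl⟩ := this.top_sums.2.2.eq_cons
    have h0 := this.pure
    have e : a - 2 * b + 2 * b = a := by omega
    rwa [e] at h0
  | case7 as bs h =>
    have key : as = [] ∧ bs = [] := by
      cases as with
      | nil =>
        cases bs with
        | nil => exact ⟨rfl, rfl⟩
        | cons b bs =>
          have := hb b List.mem_cons_self
          simp at hs
          omega
      | cons a as =>
        cases bs with
        | nil =>
          have := ha a List.mem_cons_self
          simp at hs
          omega
        | cons b bs => exact (h a as b bs rfl rfl).elim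
    obtain ⟨rfl, rfl⟩ := key
    rw [signature]
    · exact ⟨rfl, rfl, CoreData.nil.cast rfl fun v => v.elim0⟩
    · simp

/-! ### Trace functionals on an algebra of matrices with prescribed support -/

section SupportedAlgebra

variable {ι : Type*} [Fintype ι] [DecidableEq ι]

/-- The matrices supported on a preorder form an algebra. -/
def supportedAlgebra (P : ι → ι → Prop) (hr : ∀ x, P x x) (ht : ∀ x y z, P x y → P y z → P x z) :
    Subalgebra ℂ (Matrix ι ι ℂ) where
  carrier := supported P
  add_mem' := (supported P).add_mem
  algebraMap_mem' c x y h := by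
    rw [Matrix.algebraMap_matrix_apply, if_neg]
    rintro rfl
    exact h (hr _)
  mul_mem' {X Y} hX hY x z h := by
    refine Finset.sum_eq_zero fun y _ => ?_
    change X x y * Y y z = 0
    by_cases hxy : P x y
    · rw [hY y z fun hyz => h (ht x y z hxy hyz), mul_zero]
    · rw [hX x y hxy, zero_mul]

/-- The functional `X ↦ tr (M X)` on an algebra of matrices. -/
noncomputable def traceDual (A : Subalgebra ℂ (Matrix ι ι ℂ)) (M : Matrix ι ι ℂ) :
    Module.Dual ℂ A :=
  (Matrix.traceLinearMap ι ℂ ℂ ∘ₗ LinearMap.mulLeft ℂ M) ∘ₗ A.val.toLinearMap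

theorem traceDual_apply (A : Subalgebra ℂ (Matrix ι ι ℂ)) (M : Matrix ι ι ℂ) (X : A) :
    traceDual A M X = (M * X.1).trace := rfl

theorem kernelDim_traceDual (P : ι → ι → Prop) (hr : ∀ x, P x x)
    (ht : ∀ x y z, P x y → P y z → P x z) (M : Matrix ι ι ℂ) :
    kernelDim (traceDual (supportedAlgebra P hr ht) M) = radDim P M := by
  let e : supportedAlgebra P hr ht ≃ₗ[ℂ] supported P :=
    { toFun := fun X => ⟨X.1, X.2⟩
      invFun := fun X => ⟨X.1, X.2⟩
      map_add' := fun _ _ => rfl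
      map_smul' := fun _ _ => rfl
      left_inv := fun _ => rfl
      right_inv := fun _ => rfl }
  refine finrank_ker_eq_of_isometry _ _ e one_ne_zero fun X Y => ?_
  rw [one_mul]
  rfl

open scoped Matrix.Norms.Operator in
/-- The slice criterion `le_kernelDim_of_slice` for trace functionals. Transversality is tested
on the kernel of the form at the base point. -/
theorem le_kernelDim_of_trace_slice (A : Subalgebra ℂ (Matrix ι ι ℂ)) {W : Type*}
    [NormedAddCommGroup W] [NormedSpace ℂ W] [FiniteDimensional ℂ W] (M : Matrix ι ι ℂ)
    (D : W →ₗ[ℂ] Matrix ι ι ℂ)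
    (hD : ∀ X, kirillovForm (traceDual A M) X = 0 → (∀ w, (D w * X.1).trace = 0) → X = 0) (k : ℕ)
    (hk : ∀ w, k ≤ kernelDim (traceDual A (M + D w))) (f : Module.Dual ℂ A) : k ≤ kernelDim f := by
  have add : ∀ M M' : Matrix ι ι ℂ, traceDual A (M + M') = traceDual A M + traceDual A M' := by
    intro M M'
    ext X
    simp [traceDual_apply, Matrix.add_mul]
  let H : W →ₗ[ℂ] Module.Dual ℂ A :=
    { toFun := fun w => traceDual A (D w)
      map_add' := fun w w' => by rw [map_add, add]
      map_smul' := fun c w => by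
        ext X
        simp [traceDual_apply] }
  refine le_kernelDim_of_slice (traceDual A M) H ?_ k (fun w => ?_) f
  · suffices hbot : (LinearMap.range H ⊔
        LinearMap.range (kirillovForm (traceDual A M))).dualCoannihilator = ⊥ by
      rw [← Subspace.dualCoannihilator_dualAnnihilator_eq
        (W := LinearMap.range H ⊔ LinearMap.range (kirillovForm (traceDual A M))), hbot,
        Submodule.dualAnnihilator_bot]
    refine (Submodule.eq_bot_iff _).2 fun X hX => ?_
    rw [Submodule.mem_dualCoannihilator] at hX
    refine hD X (LinearMap.ext fun Y => ?_) fun w => hX _ (Submodule.mem_sup_left ⟨w, rfl⟩)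
    have : kirillovForm (traceDual A M) Y X = 0 := hX _ (Submodule.mem_sup_right ⟨Y, rfl⟩)
    rw [kirillovForm_apply, ← lie_skew, map_neg, neg_eq_zero] at this
    exact this
  · exact (hk w).trans_eq (congrArg kernelDim (add _ _))

end SupportedAlgebra

/-- Here `G` extends the coefficients of `F` by arbitrary values to all natural indices. -/
theorem kernelDim_gl {c : ℕ} (F : Module.Dual ℂ (gl c)) (G : ℕ → ℕ → ℂ)
    (hG : ∀ p q : Fin c, G p q = coeff F p q) : kernelDim F = glRadDim c G := by
  let e : gl c ≃ₗ[ℂ] supported fun _ _ : Fin c => True :=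
    { toFun := fun X => ⟨X, fun _ _ h => (h trivial).elim⟩
      invFun := fun X => X.1
      map_add' := fun _ _ => rfl
      map_smul' := fun _ _ => rfl
      left_inv := fun _ => rfl
      right_inv := fun _ => rfl }
  refine finrank_ker_eq_of_isometry _ _ e one_ne_zero fun X Y => ?_
  have key : ∀ Z : gl c, F Z = (Matrix.of (fun x y : Fin c => G y x) * Z).trace := by
    intro Z
    conv_lhs => rw [Matrix.matrix_eq_sum_single Z]
    simp only [map_sum, Matrix.trace, Matrix.diag, Matrix.mul_apply, Matrix.of_apply]
    rw [Finset.sum_comm]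
    refine Finset.sum_congr rfl fun y _ => Finset.sum_congr rfl fun x _ => ?_
    rw [hG, coeff, mul_comm, ← smul_eq_mul, ← map_smul, Matrix.smul_single, smul_eq_mul, mul_one]
  rw [one_mul, kirillovForm_apply, key, Ring.lie_def]
  rfl

theorem glRadDim_zero (c : ℕ) : glRadDim c (fun _ _ => 0) = c * c := by
  rw [← kernelDim_gl (0 : Module.Dual ℂ (gl c)) _ fun _ _ => rfl, kernelDim]
  have : kirillovForm (0 : Module.Dual ℂ (gl c)) = 0 := by
    ext
    rfl
  rw [this, LinearMap.ker_zero, finrank_top, Module.finrank_matrix]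
  simp

/-! ### The index -/

theorem allowed_refl (top bot : List ℕ) (u : ℕ) : Allowed top bot u u := ⟨le_rfl, le_rfl⟩

theorem allowed_trans (top bot : List ℕ) (u v w : ℕ) (h : Allowed top bot u v)
    (h' : Allowed top bot v w) : Allowed top bot u w :=
  ⟨h.1.trans h'.1, h'.2.trans h.2⟩

namespace CoreData

variable {N : ℕ} {top bot : List ℕ} {lab : Fin N → ℕ} {cs : List ℕ}

/-- The algebra of the matrices with the support of the seaweed, in the coordinates given by the
component meander. -/
abbrev algebra (N : ℕ) (top bot : List ℕ) (lab : Fin N → ℕ) (cs : List ℕ) :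
    Subalgebra ℂ
      (Matrix (BlowUp fun v => cs.getD (lab v) 0) (BlowUp fun v => cs.getD (lab v) 0) ℂ) :=
  supportedAlgebra (fun x y => Allowed top bot x.1 y.1) (fun _ => allowed_refl _ _ _)
    fun _ _ _ => allowed_trans _ _ _ _ _

/-- The matrix of the functional attached to the component meander with coefficients `F`. -/
noncomputable abbrev matrix (N : ℕ) (top bot : List ℕ) (lab : Fin N → ℕ) (cs : List ℕ)
    (F : ℕ → ℕ → ℕ → ℂ) :
    Matrix (BlowUp fun v => cs.getD (lab v) 0) (BlowUp fun v => cs.getD (lab v) 0) ℂ :=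
  meanderMatrix _ (fun u v : Fin N => Edge top bot u v) lab (fun _ => 1) F

open Classical in
theorem matrix_apply (F : ℕ → ℕ → ℕ → ℂ) (x y : BlowUp fun v => cs.getD (lab v) 0) :
    matrix N top bot lab cs F x y = (if y.1 = x.1 then F (lab x.1) y.2 x.2 else 0) +
      if Edge top bot y.1 x.1 ∧ (y.2 : ℕ) = x.2 then 1 else 0 := by
  change meanderMatrix _ _ _ _ _ x y = _
  rw [meanderMatrix, Nat.cast_one, one_mul]
  congr

theorem kernelDim_matrix (h : CoreData N top bot lab cs) (F : ℕ → ℕ → ℕ → ℂ) :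
    kernelDim (traceDual (algebra N top bot lab cs) (matrix N top bot lab cs F)) =
      ∑ i ∈ Finset.range cs.length, glRadDim (cs.getD i 0) (F i) := by
  rw [kernelDim_traceDual, h.radDim_eq _ fun _ => one_pos]

/-- The families of one `c_i × c_i` matrix for each component. -/
abbrev Blocks (cs : List ℕ) : Type :=
  (Σ i : Fin cs.length, Fin (cs.get i) × Fin (cs.get i)) → ℂ

/-- The entries of a family of matrices, extended by zero to all natural indices. -/
def entry (w : Blocks cs) (i p q : ℕ) : ℂ :=
  if h : i < cs.length then
    if h' : p < cs.get ⟨i, h⟩ ∧ q < cs.get ⟨i, h⟩ then w ⟨⟨i, h⟩, ⟨p, h'.1⟩, ⟨q, h'.2⟩⟩ else 0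
  else 0

theorem entry_star (w : Blocks cs) (i p q : ℕ) :
    entry (fun z : Σ i : Fin cs.length, Fin (cs.get i) × Fin (cs.get i) =>
      star (w ⟨z.1, z.2.2, z.2.1⟩)) i p q = star (entry w i q p) := by
  by_cases h : i < cs.length
  · by_cases h' : p < cs.get ⟨i, h⟩ ∧ q < cs.get ⟨i, h⟩
    · rw [entry, entry, dif_pos h, dif_pos h, dif_pos h', dif_pos h'.symm]
    · rw [entry, entry, dif_pos h, dif_pos h, dif_neg h', dif_neg fun h'' => h' h''.symm, star_zero]
  · rw [entry, entry, dif_neg h, dif_neg h, star_zero]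

/-- The block diagonal matrix with the same block at all vertices of a component. -/
def diagonal (lab : Fin N → ℕ) : Blocks cs →ₗ[ℂ]
    Matrix (BlowUp fun v => cs.getD (lab v) 0) (BlowUp fun v => cs.getD (lab v) 0) ℂ where
  toFun w := Matrix.of fun x y => if y.1 = x.1 then entry w (lab x.1) x.2 y.2 else 0
  map_add' w w' := by
    ext x y
    simp only [Matrix.add_apply, Matrix.of_apply, entry]
    split_ifs <;> simp
  map_smul' c w := by
    ext x y
    simp only [Matrix.smul_apply, Matrix.of_apply, entry]
    split_ifs <;> simp

theorem diagonal_apply (w : Blocks cs) (x y : BlowUp fun v => cs.getD (lab v) 0) :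
    diagonal lab w x y = if y.1 = x.1 then entry w (lab x.1) x.2 y.2 else 0 := rfl

theorem matrix_add_diagonal (w : Blocks cs) :
    matrix N top bot lab cs (fun _ _ _ => 0) + diagonal lab w =
      matrix N top bot lab cs fun i p q => entry w i q p := by
  ext x y
  rw [Matrix.add_apply, diagonal_apply, matrix_apply, matrix_apply, ite_self, zero_add, add_comm]

theorem diagonal_mem (w : Blocks cs) : diagonal lab w ∈ algebra N top bot lab cs := by
  intro x y hxy
  rw [diagonal_apply, if_neg]
  intro he
  refine hxy ?_
  change Allowed top bot x.1 y.1
  rw [he]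
  exact allowed_refl _ _ _

theorem diagonal_commute (h : CoreData N top bot lab cs) (w : Blocks cs) :
    matrix N top bot lab cs (fun _ _ _ => 0) * diagonal lab w =
      diagonal lab w * matrix N top bot lab cs fun _ _ _ => 0 := by
  classical
  ext x z
  rw [Matrix.mul_apply, Matrix.mul_apply]
  have hM : ∀ x y, matrix N top bot lab cs (fun _ _ _ => 0) x y =
      if Edge top bot y.1 x.1 ∧ (y.2 : ℕ) = x.2 then 1 else 0 := by
    intro x y
    rw [matrix_apply, ite_self, zero_add]
  simp only [hM, diagonal_apply]
  by_cases hE : Edge top bot z.1 x.1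
  · have hl : lab z.1 = lab x.1 := h.label_edge _ _ hE
    have hx : (x.2 : ℕ) < cs.getD (lab z.1) 0 := hl ▸ x.2.2
    have hz : (z.2 : ℕ) < cs.getD (lab x.1) 0 := hl ▸ z.2.2
    rw [Finset.sum_eq_single (⟨z.1, x.2, hx⟩ : BlowUp fun v => cs.getD (lab v) 0),
      Finset.sum_eq_single (⟨x.1, z.2, hz⟩ : BlowUp fun v => cs.getD (lab v) 0)]
    · simp [hE, hl]
    · intro y _ hy
      by_cases h1 : y.1 = x.1
      · rw [if_pos h1, if_neg, mul_zero]
        rintro ⟨-, h2⟩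
        exact hy (blowUp_ext.2 ⟨h1, h2.symm⟩)
      · rw [if_neg h1, zero_mul]
    · simp
    · intro y _ hy
      by_cases h1 : z.1 = y.1
      · rw [if_neg, zero_mul]
        rintro ⟨-, h2⟩
        exact hy (blowUp_ext.2 ⟨h1.symm, h2⟩)
      · rw [if_neg h1, mul_zero]
    · simp
  · rw [Finset.sum_eq_zero, Finset.sum_eq_zero]
    · intro y _
      by_cases h1 : y.1 = x.1
      · rw [if_neg (c := _ ∧ _), mul_zero]
        rintro ⟨h2, -⟩
        exact hE (h1 ▸ h2)
      · rw [if_neg h1, zero_mul]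
    · intro y _
      by_cases h1 : z.1 = y.1
      · rw [if_neg (c := _ ∧ _), zero_mul]
        rintro ⟨h2, -⟩
        exact hE (h1 ▸ h2)
      · rw [if_neg h1, mul_zero]

theorem diagonal_injective (hlab : ∀ i < cs.length, ∃ v, lab v = i) :
    Function.Injective (diagonal lab (cs := cs)) := by
  rw [← LinearMap.ker_eq_bot, LinearMap.ker_eq_bot']
  intro w hw
  ext ⟨⟨i, hi⟩, p, q⟩
  obtain ⟨v, rfl⟩ := hlab i hi
  have hc : cs.getD (lab v) 0 = cs.get ⟨lab v, hi⟩ := by simp [hi]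
  have := congrFun (congrFun hw ⟨v, Fin.cast hc.symm p⟩) ⟨v, Fin.cast hc.symm q⟩
  rw [diagonal_apply, if_pos rfl] at this
  simpa [entry, hi] using this

/-- At the functional without core coefficients, the kernel of the form consists of the block
diagonal matrices that are constant along the paths: these do lie in the kernel, and the kernel
has dimension `∑ c_i²`. -/
theorem exists_diagonal (h : CoreData N top bot lab cs) (hlab : ∀ i < cs.length, ∃ v, lab v = i)
    (X : algebra N top bot lab cs)
    (hX : kirillovForm (traceDual _ (matrix N top bot lab cs fun _ _ _ => 0)) X = 0) :
    ∃ w : Blocks cs, diagonal lab w = X.1 := by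
  let d : Blocks cs →ₗ[ℂ] algebra N top bot lab cs :=
    { toFun := fun w => ⟨diagonal lab w, diagonal_mem w⟩
      map_add' := fun w w' => Subtype.ext (map_add (diagonal lab) w w')
      map_smul' := fun c w => Subtype.ext (map_smul (diagonal lab) c w) }
  have hd : LinearMap.range d =
      LinearMap.ker (kirillovForm (traceDual _ (matrix N top bot lab cs fun _ _ _ => 0))) := by
    refine Submodule.eq_of_le_of_finrank_eq ?_ ?_
    · rintro _ ⟨w, rfl⟩
      refine LinearMap.mem_ker.2 (LinearMap.ext fun Y => ?_)
      have := traceForm_apply' (fun x y : BlowUp fun v => cs.getD (lab v) 0 =>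
        Allowed top bot x.1 y.1) (matrix N top bot lab cs fun _ _ _ => 0)
        ⟨diagonal lab w, diagonal_mem w⟩ ⟨Y.1, Y.2⟩
      rw [h.diagonal_commute, sub_self, Matrix.zero_mul, Matrix.trace_zero] at this
      exact this
    · rw [LinearMap.finrank_range_of_inj
        fun w w' hw => diagonal_injective hlab (congrArg Subtype.val hw)]
      refine Eq.trans ?_ (h.kernelDim_matrix fun _ _ _ => 0).symm
      simp only [glRadDim_zero, Module.finrank_fintype_fun_eq_card, Fintype.card_sigma,
        Fintype.card_prod, Fintype.card_fin]
      rw [← Fin.sum_univ_eq_sum_range (fun i => cs.getD i 0 * cs.getD i 0)]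
      simp
  obtain ⟨w, hw⟩ : X ∈ LinearMap.range d := hd ▸ hX
  exact ⟨w, congrArg Subtype.val hw⟩

open scoped ComplexOrder in
/-- The functionals with the peak entries of the component meander and arbitrary core
coefficients form a transversal slice. -/
theorem le_kernelDim (h : CoreData N top bot lab cs) (hlab : ∀ i < cs.length, ∃ v, lab v = i)
    (k : ℕ → ℕ) (hk : ∀ i < cs.length, ∀ G, k i ≤ glRadDim (cs.getD i 0) G)
    (f : Module.Dual ℂ (algebra N top bot lab cs)) :
    ∑ i ∈ Finset.range cs.length, k i ≤ kernelDim f := by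
  refine le_kernelDim_of_trace_slice _ (matrix N top bot lab cs fun _ _ _ => 0) (diagonal lab)
    (fun X hX hX' => ?_) _ (fun w => ?_) f
  · obtain ⟨w, hw⟩ := h.exists_diagonal hlab X hX
    -- The trace form pairs the block diagonal matrices nondegenerately with themselves.
    have hstar : diagonal lab (fun z : Σ i : Fin cs.length, Fin (cs.get i) × Fin (cs.get i) =>
        star (w ⟨z.1, z.2.2, z.2.1⟩)) = X.1.conjTranspose := by
      rw [← hw]
      ext x y
      rw [Matrix.conjTranspose_apply, diagonal_apply, diagonal_apply]
      by_cases hxy : y.1 = x.1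
      · have hl : lab y.1 = lab x.1 := congrArg lab hxy
        rw [if_pos hxy, if_pos hxy.symm, hl, entry_star]
      · rw [if_neg hxy, if_neg (Ne.symm hxy), star_zero]
    have := hX' fun z : Σ i : Fin cs.length, Fin (cs.get i) × Fin (cs.get i) =>
      star (w ⟨z.1, z.2.2, z.2.1⟩)
    rw [hstar, Matrix.trace_conjTranspose_mul_self_eq_zero_iff] at this
    exact Subtype.ext this
  · rw [matrix_add_diagonal, h.kernelDim_matrix]
    exact Finset.sum_le_sum fun i hi => hk i (Finset.mem_range.1 hi) _

end CoreData

/-! ### Coordinates on the seaweed given by the component meander -/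

namespace BlockSums

theorem sum_eq {Z ts as : List ℕ} (h : BlockSums Z ts as) : Z.sum = as.sum := by
  induction ts generalizing Z as with
  | nil =>
    cases as with
    | nil => rw [show Z = [] from h]
    | cons a as => exact h.elim
  | cons t ts ih =>
    cases as with
    | nil => exact h.elim
    | cons a as =>
      obtain ⟨-, h2, h3⟩ := h
      rw [List.sum_cons, ← ih h3, ← h2, List.sum_take_add_sum_drop]

theorem blockIndex_lt {Z ts as : List ℕ} (h : BlockSums Z ts as) {v : ℕ} (hv : v < Z.length) :
    blockIndex ts v < as.length := by
  induction ts generalizing Z as v with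
  | nil =>
    cases as with
    | nil =>
      rw [show Z = [] from h] at hv
      exact absurd hv (Nat.not_lt_zero _)
    | cons a as => exact h.elim
  | cons t ts ih =>
    cases as with
    | nil => exact h.elim
    | cons a as =>
      obtain ⟨h1, h2, h3⟩ := h
      rw [blockIndex, List.length_cons]
      split_ifs with hvt
      · exact Nat.succ_pos _
      · exact Nat.succ_lt_succ (ih h3 (by rw [List.length_drop]; omega))

/-- A position in the interval of the vertex `v` lies in the first `i` blocks of the seaweed if
and only if `v` lies in the first `i` blocks of the component meander. -/
theorem lt_sum_take_iff {Z ts as : List ℕ} (h : BlockSums Z ts as) {v s : ℕ} (hv : v < Z.length)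
    (hs : s < Z[v]) (i : ℕ) :
    (Z.take v).sum + s < (as.take i).sum ↔ blockIndex ts v < i := by
  induction ts generalizing Z as v i with
  | nil =>
    cases as with
    | nil =>
      obtain rfl : Z = [] := h
      exact absurd hv (Nat.not_lt_zero _)
    | cons a as => exact h.elim
  | cons t ts ih =>
    cases as with
    | nil => exact h.elim
    | cons a as =>
      obtain ⟨h1, h2, h3⟩ := h
      cases i with
      | zero => simp
      | succ i =>
        rw [blockIndex, List.take_succ_cons, List.sum_cons]
        split_ifs with hvt
        · refine iff_of_true ?_ (Nat.succ_pos _)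
          have e : t = v + 1 + (t - (v + 1)) := by omega
          rw [← h2, e, List.take_add, List.sum_append, List.sum_take_succ _ _ hv]
          omega
        · obtain ⟨v, rfl⟩ := Nat.exists_eq_add_of_le (not_lt.1 hvt)
          have := ih h3 (v := v) (by rw [List.length_drop]; omega)
            (by rw [List.getElem_drop]; exact hs) i
          rw [List.take_add, List.sum_append, h2, Nat.add_sub_cancel_left, Nat.succ_lt_succ_iff,
            ← this]
          omega

end BlockSums

theorem span_single_eq {n : ℕ} (p : Fin n → Prop) :
    (Submodule.span ℂ {v : Fin n → ℂ | ∃ k, p k ∧ v = Pi.single k 1} : Set (Fin n → ℂ)) =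
      {v | ∀ k, ¬p k → v k = 0} := by
  ext v
  constructor
  · intro hv
    let S : Submodule ℂ (Fin n → ℂ) :=
      { carrier := {v | ∀ k, ¬p k → v k = 0}
        add_mem' := fun hv hw k hk => by rw [Pi.add_apply, hv k hk, hw k hk, add_zero]
        zero_mem' := fun _ _ => rfl
        smul_mem' := fun c v hv k hk => by rw [Pi.smul_apply, hv k hk, smul_zero] }
    refine (Submodule.span_le (p := S)).2 ?_ hv
    rintro _ ⟨k, hk, rfl⟩ l hl
    refine Pi.single_eq_of_ne ?_ _
    rintro rfl
    exact hl hk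
  · intro hv
    rw [SetLike.mem_coe, pi_eq_sum_univ' v]
    refine Submodule.sum_mem _ fun k _ => ?_
    by_cases hk : p k
    · refine Submodule.smul_mem _ _ (Submodule.subset_span ⟨k, hk, ?_⟩)
      ext l
      simp [Pi.single_apply]
    · rw [hv k hk, zero_smul]
      exact zero_mem _

/-- A matrix preserves a coordinate subspace if and only if the corresponding block vanishes. -/
theorem mulVec_mem_span_iff {n : ℕ} (p : Fin n → Prop) (X : gl n) :
    (∀ v ∈ Submodule.span ℂ {v : Fin n → ℂ | ∃ k, p k ∧ v = Pi.single k 1},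
      X.mulVec v ∈ Submodule.span ℂ {v : Fin n → ℂ | ∃ k, p k ∧ v = Pi.single k 1}) ↔
    ∀ k l, p l → ¬p k → X k l = 0 := by
  simp only [← SetLike.mem_coe, span_single_eq, Set.mem_ofPred_eq]
  constructor
  · intro h k l hl hk
    have := h (Pi.single l 1) (fun j hj => Pi.single_eq_of_ne (by rintro rfl; exact hj hl) _) k hk
    simpa using this
  · intro h v hv k hk
    rw [Matrix.mulVec, dotProduct]
    refine Finset.sum_eq_zero fun l _ => ?_
    by_cases hl : p l
    · rw [h k l hl hk, zero_mul]
    · rw [hv l hl, mul_zero]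

section Coordinates

variable {n : ℕ} (a b : Composition n)

theorem isComponentMeander :
    IsComponentMeander (componentMeander a b) (homotopyType a b) a.blocks b.blocks :=
  isComponentMeander_windUp _ _ (fun _ => a.blocks_pos) (fun _ => b.blocks_pos)
    (a.blocks_sum.trans b.blocks_sum.symm)

/-- The sizes of the vertices of the component meander, from left to right. -/
abbrev sizes : List ℕ := (componentMeander a b).label.map fun i => (homotopyType a b).getD i 0

theorem ofFn_size : List.ofFn (size a b) = sizes a b := by
  refine List.ext_getElem (by simp) fun i h1 h2 => ?_
  simp [size, componentOf]

theorem sum_size : ∑ v, size a b v = n := by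
  rw [← List.sum_ofFn, ofFn_size, (isComponentMeander a b).top_sums.sum_eq, a.blocks_sum]

theorem offset_eq (v : CMVertex a b) : offset a b v = ((sizes a b).take v).sum := by
  rw [← ofFn_size, List.sum_take_ofFn]
  rfl

theorem offset_add_size_le {u v : CMVertex a b} (h : u < v) :
    offset a b u + size a b u ≤ offset a b v := by
  rw [offset, add_comm, ← Finset.sum_insert (by simp)]
  refine Finset.sum_le_sum_of_subset fun w hw => ?_
  rw [Finset.mem_insert, Finset.mem_filter] at hw
  rw [Finset.mem_filter]
  rcases hw with rfl | ⟨-, hw⟩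
  · exact ⟨Finset.mem_univ _, h⟩
  · exact ⟨Finset.mem_univ _, hw.trans h⟩

theorem offset_add_size_le_card (v : CMVertex a b) : offset a b v + size a b v ≤ n := by
  refine le_of_le_of_eq ?_ (sum_size a b)
  rw [offset, add_comm, ← Finset.sum_insert (by simp)]
  exact Finset.sum_le_sum_of_subset (Finset.subset_univ _)

/-- The index set `{1, …, n}` as the disjoint union of the intervals `A_v`. -/
noncomputable def coordEquiv : BlowUp (size a b) ≃ Fin n :=
  Equiv.ofBijective
    (fun x => ⟨offset a b x.1 + x.2, by
      have := offset_add_size_le_card a b x.1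
      have := x.2.2
      omega⟩) (by
    rw [Fintype.bijective_iff_injective_and_card]
    constructor
    · intro x y hxy
      have hxy' : offset a b x.1 + x.2 = offset a b y.1 + y.2 := congrArg Fin.val hxy
      have hx := x.2.2
      have hy := y.2.2
      rcases lt_trichotomy x.1 y.1 with h | h | h
      · have := offset_add_size_le a b h
        omega
      · have := congrArg (offset a b) h
        exact blowUp_ext.2 ⟨h, by omega⟩
      · have := offset_add_size_le a b h
        omega
    · rw [Fintype.card_sigma, Fintype.card_fin]
      simp only [Fintype.card_fin]
      exact sum_size a b)

/-- The coordinate equivalence, with a permutation of each of the intervals. -/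
noncomputable def permCoord (σ : ∀ v, Equiv.Perm (Fin (size a b v))) : BlowUp (size a b) ≃ Fin n :=
  (Equiv.sigmaCongrRight σ).trans (coordEquiv a b)

theorem permCoord_val (σ : ∀ v, Equiv.Perm (Fin (size a b v))) (x : BlowUp (size a b)) :
    (permCoord a b σ x : ℕ) = offset a b x.1 + σ x.1 x.2 := rfl

theorem permCoord_lt_iff {top as : List ℕ} (h : BlockSums (sizes a b) top as)
    (σ : ∀ v, Equiv.Perm (Fin (size a b v))) (x : BlowUp (size a b)) (i : ℕ) :
    (permCoord a b σ x : ℕ) < (as.take i).sum ↔ blockIndex top x.1 < i := by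
  have hx : (x.1 : ℕ) < (sizes a b).length := by
    rw [List.length_map]
    exact x.1.2
  rw [permCoord_val, offset_eq]
  refine h.lt_sum_take_iff hx ?_ i
  rw [List.getElem_map]
  exact (σ x.1 x.2).2

theorem blockIndex_le_iff {top as : List ℕ} (h : BlockSums (sizes a b) top as)
    (σ : ∀ v, Equiv.Perm (Fin (size a b v))) (x y : BlowUp (size a b)) :
    blockIndex top x.1 ≤ blockIndex top y.1 ↔
      ∀ i ≤ as.length, (permCoord a b σ y : ℕ) < (as.take i).sum →
        (permCoord a b σ x : ℕ) < (as.take i).sum := by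
  simp only [permCoord_lt_iff a b h]
  constructor
  · intro hxy i _ hi
    exact hxy.trans_lt hi
  · intro hxy
    have hy : (y.1 : ℕ) < (sizes a b).length := by
      rw [List.length_map]
      exact y.1.2
    exact Nat.lt_succ_iff.1 (hxy _ (h.blockIndex_lt hy) (Nat.lt_succ_self _))

/-- The algebra of the matrices with the support of the seaweed, in the coordinates given by the
component meander. -/
abbrev coordAlgebra : Subalgebra ℂ (Matrix (BlowUp (size a b)) (BlowUp (size a b)) ℂ) :=
  CoreData.algebra (componentMeander a b).label.length (componentMeander a b).top
    (componentMeander a b).bottom (componentMeander a b).label.get (homotopyType a b)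

/-- The seaweed consists of the matrices that are supported on `Allowed`: the top blocks of the
component meander account for the subspaces `V_i` and its bottom blocks for the subspaces `W_j`. -/
theorem mem_seaweed_iff (σ : ∀ v, Equiv.Perm (Fin (size a b v))) (X : gl n) :
    X ∈ seaweed a b ↔ X.submatrix (permCoord a b σ) (permCoord a b σ) ∈ coordAlgebra a b := by
  have h1 : X ∈ seaweed a b ↔
      (∀ i ≤ a.length, ∀ k l : Fin n, (l : ℕ) < a.sizeUpTo i → ¬(k : ℕ) < a.sizeUpTo i →
        X k l = 0) ∧
      ∀ j ≤ b.length, ∀ k l : Fin n, b.sizeUpTo j ≤ (l : ℕ) → ¬b.sizeUpTo j ≤ (k : ℕ) →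
        X k l = 0 :=
    and_congr (forall₂_congr fun i _ => mulVec_mem_span_iff _ X)
      (forall₂_congr fun j _ => mulVec_mem_span_iff _ X)
  have h2 : X.submatrix (permCoord a b σ) (permCoord a b σ) ∈ coordAlgebra a b ↔
      ∀ x y : BlowUp (size a b), ¬(blockIndex (componentMeander a b).top x.1 ≤
        blockIndex (componentMeander a b).top y.1 ∧ blockIndex (componentMeander a b).bottom y.1 ≤
        blockIndex (componentMeander a b).bottom x.1) →
        X (permCoord a b σ x) (permCoord a b σ y) = 0 := Iff.rfl
  rw [h1, h2]
  simp only [blockIndex_le_iff a b (isComponentMeander a b).top_sums σ,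
    blockIndex_le_iff a b (isComponentMeander a b).bottom_sums σ]
  constructor
  · rintro ⟨ha, hb⟩ x y hxy
    by_contra hne
    refine hxy ⟨fun i hi hy => ?_, fun j hj hx => ?_⟩
    · by_contra hx
      exact hne (ha i hi _ _ hy hx)
    · by_contra hy
      exact hne (hb j hj _ _ (not_lt.1 hy) (not_le.2 hx))
  · intro h
    have h' : ∀ k l : Fin n, ¬((∀ i ≤ a.blocks.length, (l : ℕ) < (a.blocks.take i).sum →
        (k : ℕ) < (a.blocks.take i).sum) ∧ ∀ i ≤ b.blocks.length,
        (k : ℕ) < (b.blocks.take i).sum → (l : ℕ) < (b.blocks.take i).sum) → X k l = 0 := by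
      intro k l
      have := h ((permCoord a b σ).symm k) ((permCoord a b σ).symm l)
      simpa only [Equiv.apply_symm_apply] using this
    constructor
    · exact fun i hi k l hl hk => h' k l fun hkl => hk (hkl.1 i hi hl)
    · exact fun j hj k l hl hk => h' k l fun hkl => absurd (hkl.2 j hj (not_le.1 hk)) (not_lt.2 hl)

/-- The seaweed, as a Lie algebra, in the coordinates given by the component meander. -/
noncomputable def seaweedEquiv (σ : ∀ v, Equiv.Perm (Fin (size a b v))) :
    seaweed a b ≃ₗ[ℂ] coordAlgebra a b where
  toFun X := ⟨X.1.submatrix (permCoord a b σ) (permCoord a b σ), (mem_seaweed_iff a b σ X.1).1 X.2⟩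
  invFun Y := ⟨Y.1.submatrix (permCoord a b σ).symm (permCoord a b σ).symm, by
    rw [mem_seaweed_iff a b σ, Matrix.submatrix_submatrix]
    simp⟩
  map_add' _ _ := rfl
  map_smul' _ _ := rfl
  left_inv X := Subtype.ext (by simp [Matrix.submatrix_submatrix])
  right_inv Y := Subtype.ext (by simp [Matrix.submatrix_submatrix])

theorem seaweedEquiv_lie (σ : ∀ v, Equiv.Perm (Fin (size a b v))) (X Y : seaweed a b) :
    seaweedEquiv a b σ ⁅X, Y⁆ = ⁅seaweedEquiv a b σ X, seaweedEquiv a b σ Y⁆ := by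
  refine Subtype.ext ?_
  change (X.1 * Y.1 - Y.1 * X.1).submatrix _ _ =
    X.1.submatrix _ _ * Y.1.submatrix _ _ - Y.1.submatrix _ _ * X.1.submatrix _ _
  rw [Matrix.submatrix_mul_equiv, Matrix.submatrix_mul_equiv]
  rfl

end Coordinates

/-! ### The functionals in coordinates -/

open Classical in
/-- The functional attached to the component meander, evaluated at a matrix `Y` whose entries are
given by a function `Z` of vertices and natural offsets. -/
theorem CoreData.trace_matrix_mul {N : ℕ} {top bot : List ℕ} {lab : Fin N → ℕ} {cs : List ℕ}
    (h : CoreData N top bot lab cs) (F : ℕ → ℕ → ℕ → ℂ)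
    (Y : Matrix (BlowUp fun v => cs.getD (lab v) 0) (BlowUp fun v => cs.getD (lab v) 0) ℂ)
    (Z : Fin N → ℕ → Fin N → ℕ → ℂ) (hZ : ∀ x y, Y x y = Z x.1 x.2 y.1 y.2) :
    (CoreData.matrix N top bot lab cs F * Y).trace =
      (∑ v, ∑ s ∈ Finset.range (cs.getD (lab v) 0), ∑ r ∈ Finset.range (cs.getD (lab v) 0),
        F (lab v) s r * Z v s v r) +
      ∑ u : Fin N, ∑ v : Fin N, if Edge top bot u v then
        ∑ s ∈ Finset.range (cs.getD (lab u) 0), Z u s v s else 0 := by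
  have h1 : (CoreData.matrix N top bot lab cs F * Y).trace =
      ∑ v, ∑ s ∈ Finset.range (cs.getD (lab v) 0), ∑ u, ∑ r ∈ Finset.range (cs.getD (lab u) 0),
        ((if u = v then F (lab v) r s else 0) +
          if Edge top bot u v ∧ r = s then 1 else 0) * Z u r v s := by
    simp only [Matrix.trace, Matrix.diag, Matrix.mul_apply, matrix_apply, Fintype.sum_sigma]
    refine Finset.sum_congr rfl fun v _ => ?_
    rw [← Fin.sum_univ_eq_sum_range (fun s => ∑ u, ∑ r ∈ Finset.range (cs.getD (lab u) 0),
        ((if u = v then F (lab v) r s else 0) +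
          if Edge top bot u v ∧ r = s then 1 else 0) * Z u r v s)]
    refine Finset.sum_congr rfl fun s _ => Finset.sum_congr rfl fun u _ => ?_
    rw [Finset.sum_congr rfl fun r _ => by rw [hZ]]
    exact Fin.sum_univ_eq_sum_range (fun r => ((if u = v then F (lab v) r s else 0) +
          if Edge top bot u v ∧ r = s then 1 else 0) * Z u r v s) _
  rw [h1]
  simp only [add_mul, Finset.sum_add_distrib]
  congr 1
  · refine Finset.sum_congr rfl fun v _ => ?_
    rw [Finset.sum_comm]
    refine (Finset.sum_eq_single v (fun u _ hu => ?_) (by simp)).trans ?_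
    · exact Finset.sum_eq_zero fun s _ => Finset.sum_eq_zero fun r _ => by
        rw [if_neg hu, zero_mul]
    · simp only [if_true]
      exact Finset.sum_comm
  · refine Eq.trans ?_ Finset.sum_comm
    refine Finset.sum_congr rfl fun v _ => ?_
    rw [Finset.sum_comm]
    refine Finset.sum_congr rfl fun u _ => ?_
    by_cases he : Edge top bot u v
    · have hc : cs.getD (lab v) 0 = cs.getD (lab u) 0 :=
        congrArg (fun i => cs.getD i 0) (h.label_edge u v he).symm
      rw [if_pos he, hc]
      refine Finset.sum_congr rfl fun s hs => ?_
      refine (Finset.sum_eq_single s (fun r _ hr => ?_) fun hs' => absurd hs hs').trans ?_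
      · rw [if_neg fun h' => hr h'.2, zero_mul]
      · rw [if_pos ⟨he, rfl⟩, one_mul]
    · rw [if_neg he]
      exact Finset.sum_eq_zero fun s _ => Finset.sum_eq_zero fun r _ => by
        rw [if_neg fun h' => he h'.1, zero_mul]

variable {n : ℕ} {a b : Composition n}

theorem componentOf_lt (v : CMVertex a b) : componentOf a b v < (homotopyType a b).length :=
  (isComponentMeander a b).core.label_lt v

/-- The index of the component on whose path the vertex `v` lies. -/
def component (v : CMVertex a b) : Fin (homotopyType a b).length :=
  ⟨componentOf a b v, componentOf_lt v⟩

theorem get_component (v : CMVertex a b) : (homotopyType a b).get (component v) = size a b v := by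
  simp [component, size, componentOf_lt v]

theorem sum_pathVertices (g : Fin (homotopyType a b).length → CMVertex a b → ℂ) :
    ∑ i : Fin (homotopyType a b).length, ∑ v ∈ pathVertices a b i, g i v =
      ∑ v, g (component v) v := by
  simp only [pathVertices, Finset.sum_filter]
  rw [Finset.sum_comm]
  refine Finset.sum_congr rfl fun v _ => ?_
  refine (Finset.sum_eq_single (component v) (fun i _ hi => ?_) (by simp)).trans (if_pos rfl)
  exact if_neg fun h => hi (Fin.ext h.symm)

open Classical in
theorem sum_peakSet (g : Fin (homotopyType a b).length → CMVertex a b → CMVertex a b → ℂ) :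
    ∑ i : Fin (homotopyType a b).length, ∑ P ∈ peakSet a b i, g i P.1 P.2 =
      ∑ u, ∑ v, if OrientedEdge a b u v then g (component u) u v else 0 := by
  have h1 : ∀ i : Fin (homotopyType a b).length, ∑ P ∈ peakSet a b i, g i P.1 P.2 =
      ∑ u ∈ pathVertices a b i, ∑ v, if OrientedEdge a b u v then g i u v else 0 := by
    intro i
    rw [peakSet, Finset.sum_filter, Finset.sum_product]
    refine Finset.sum_congr rfl fun u hu => ?_
    rw [pathVertices, Finset.sum_filter]
    refine Finset.sum_congr rfl fun v _ => ?_
    by_cases he : OrientedEdge a b u v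
    · refine if_pos ?_
      have : componentOf a b u = componentOf a b v :=
        (isComponentMeander a b).core.label_edge u v he
      rw [← this]
      exact (Finset.mem_filter.1 hu).2
    · simp [he]
  rw [Finset.sum_congr rfl fun i _ => h1 i, sum_pathVertices]

variable (F : ComponentFunctionals a b)

/-- The coefficients of the functionals `F_{c_i}`, extended by zero to all natural indices. -/
noncomputable def coeffs (i p q : ℕ) : ℂ :=
  if h : i < (homotopyType a b).length then
    if h' : p < (homotopyType a b).get ⟨i, h⟩ ∧ q < (homotopyType a b).get ⟨i, h⟩ then
      coeff (F ⟨i, h⟩) ⟨p, h'.1⟩ ⟨q, h'.2⟩ else 0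
  else 0

theorem coeffs_eq (i : Fin (homotopyType a b).length) (p q : Fin ((homotopyType a b).get i)) :
    coeffs F i p q = coeff (F i) p q := by
  rw [coeffs, dif_pos i.2, dif_pos ⟨p.2, q.2⟩]

theorem kernelDim_component (i : Fin (homotopyType a b).length) :
    kernelDim (F i) = glRadDim ((homotopyType a b).getD i 0) (coeffs F i) := by
  have : (homotopyType a b).getD i 0 = (homotopyType a b).get i := by simp
  rw [this]
  exact kernelDim_gl _ _ (coeffs_eq F i)

theorem sum_coeff (v : CMVertex a b) (g : ℕ → ℕ → ℂ) :
    ∑ p, ∑ q, coeff (F (component v)) p q * g p q =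
      ∑ p ∈ Finset.range (size a b v), ∑ q ∈ Finset.range (size a b v),
        coeffs F (componentOf a b v) p q * g p q := by
  rw [← get_component, ← Fin.sum_univ_eq_sum_range
    (fun p => ∑ q ∈ Finset.range _, coeffs F (componentOf a b v) p q * g p q)]
  refine Finset.sum_congr rfl fun p _ => ?_
  rw [← Fin.sum_univ_eq_sum_range (fun q => coeffs F (componentOf a b v) p q * g p q)]
  refine Finset.sum_congr rfl fun q _ => ?_
  rw [← coeffs_eq]
  rfl

theorem shift_apply {c : ℕ} (G : Module.Dual ℂ (gl c)) (k : ℕ) (X : gl n) :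
    shift G n k X = ∑ p, ∑ q, coeff G p q * entryDual n (p + k) (q + k) X := by
  simp [shift]

theorem entryDual_val (k l : Fin n) (X : gl n) : entryDual n k l X = X k l := by
  rw [entryDual, dif_pos ⟨k.2, l.2⟩]
  rfl

theorem coeff_sum {c : ℕ} (g : Fin c → Fin c → ℂ) (p q : Fin c) :
    coeff (∑ p, ∑ q, g p q • entryDual c p q) p q = g p q := by
  rw [coeff]
  simp only [LinearMap.sum_apply, LinearMap.smul_apply, entryDual_val, Matrix.single_apply,
    smul_eq_mul]
  rw [Finset.sum_eq_single p, Finset.sum_eq_single q]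
  · simp
  · intro s _ hs
    rw [if_neg fun h => hs h.2.symm, mul_zero]
  · simp
  · intro r _ hr
    exact Finset.sum_eq_zero fun s _ => by rw [if_neg fun h => hr h.1.symm, mul_zero]
  · simp

theorem lieIndex_gl_le (c : ℕ) (G : ℕ → ℕ → ℂ) : lieIndex (gl c) ≤ glRadDim c G := by
  rw [← kernelDim_gl (∑ p : Fin c, ∑ q : Fin c, G p q • entryDual c p q) G
    fun p q => (coeff_sum (fun p q : Fin c => G p q) p q).symm]
  exact lieIndex_le _

theorem coeff_rotate {c : ℕ} (G : Module.Dual ℂ (gl c)) (p q : Fin c) :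
    coeff (rotate G) p q = coeff G p.rev q.rev := by
  have : rotate G = ∑ p : Fin c, ∑ q : Fin c, coeff G p.rev q.rev • entryDual c p q := by
    rw [rotate, ← Equiv.sum_comp Fin.revPerm]
    refine Finset.sum_congr rfl fun p _ => ?_
    rw [← Equiv.sum_comp Fin.revPerm]
    simp
  rw [this, coeff_sum fun p q => coeff G p.rev q.rev]

theorem shift_rotate_apply {c : ℕ} (G : Module.Dual ℂ (gl c)) (k : ℕ) (X : gl n) :
    shift (rotate G) n k X =
      ∑ p : Fin c, ∑ q : Fin c, coeff G p q * entryDual n (p.rev + k) (q.rev + k) X := by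
  rw [shift_apply, ← Equiv.sum_comp Fin.revPerm]
  refine Finset.sum_congr rfl fun p _ => ?_
  rw [← Equiv.sum_comp Fin.revPerm]
  refine Finset.sum_congr rfl fun q _ => ?_
  rw [coeff_rotate, Fin.revPerm_apply, Fin.revPerm_apply, Fin.rev_rev, Fin.rev_rev]

/-- The functional attached to the component meander with the given core coefficients. -/
noncomputable def coordDual : Module.Dual ℂ (coordAlgebra a b) :=
  traceDual (coordAlgebra a b) (CoreData.matrix (componentMeander a b).label.length
    (componentMeander a b).top (componentMeander a b).bottom (componentMeander a b).label.get
    (homotopyType a b) (coeffs F))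

theorem kernelDim_coordDual : kernelDim (coordDual F) = ∑ i, kernelDim (F i) := by
  refine ((isComponentMeander a b).core.kernelDim_matrix (coeffs F)).trans ?_
  rw [← Fin.sum_univ_eq_sum_range
    (fun i => glRadDim ((homotopyType a b).getD i 0) (coeffs F i))]
  exact Finset.sum_congr rfl fun i _ => (kernelDim_component F i).symm

open Classical in
/-- The functional of the component meander in terms of the entries of a matrix in the seaweed, when
the intervals are permuted by `σ`. -/
theorem coordDual_seaweedEquiv (σ : ∀ v, Equiv.Perm (Fin (size a b v))) (τ : CMVertex a b → ℕ → ℕ)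
    (hτ : ∀ v s, (σ v s : ℕ) = τ v s) (X : seaweed a b) :
    coordDual F (seaweedEquiv a b σ X) =
      (∑ v, ∑ p, ∑ q, coeff (F (component v)) p q *
        entryDual n (offset a b v + τ v p) (offset a b v + τ v q) X.1) +
      ∑ u, ∑ v, if OrientedEdge a b u v then ∑ s ∈ Finset.range (size a b u),
        entryDual n (offset a b u + τ u s) (offset a b v + τ v s) X.1 else 0 := by
  have key : ∀ x y : BlowUp (size a b), X.1 (permCoord a b σ x) (permCoord a b σ y) =
      entryDual n (offset a b x.1 + τ x.1 x.2) (offset a b y.1 + τ y.1 y.2) X.1 := by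
    intro x y
    refine (entryDual_val _ _ _).symm.trans ?_
    rw [permCoord_val, permCoord_val, hτ, hτ]
  refine ((isComponentMeander a b).core.trace_matrix_mul (coeffs F) _ (fun u s v r =>
    entryDual n (offset a b u + τ u s) (offset a b v + τ v r) X.1) key).trans ?_
  congr 1
  · refine Finset.sum_congr rfl fun v _ => ?_
    exact (sum_coeff F v fun p q =>
      entryDual n (offset a b v + τ v p) (offset a b v + τ v q) X.1).symm

theorem bar_eq :
    bar F = (coordDual F).comp (seaweedEquiv a b fun _ => Equiv.refl _).toLinearMap := by
  ext X
  refine Eq.trans ?_ (coordDual_seaweedEquiv F (fun _ => Equiv.refl _) (fun _ s => s)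
    (fun _ _ => rfl) X).symm
  change (∑ i, barComponent F i) X.1 = _
  rw [LinearMap.sum_apply]
  simp only [barComponent, LinearMap.add_apply, LinearMap.sum_apply, Finset.sum_add_distrib,
    shift_apply]
  congr 1
  · rw [sum_pathVertices fun i v => ∑ p, ∑ q, coeff (F i) p q *
      entryDual n (p + offset a b v) (q + offset a b v) X.1]
    simp only [add_comm]
  · rw [sum_peakSet fun i u v => ∑ s ∈ Finset.range ((homotopyType a b).get i),
      entryDual n (offset a b u + s) (offset a b v + s) X.1]
    simp only [get_component]

/-- The parity of the distance between two vertices of a path is read off from a proper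
two-colouring. -/
theorem oddPath_iff {col : CMVertex a b → Bool}
    (hcol : ∀ u v, OrientedEdge a b u v → col u ≠ col v) {u v : CMVertex a b}
    (h : componentOf a b u = componentOf a b v) : OddPath a b u v ↔ col u ≠ col v := by
  have walk : ∀ {u v : CMVertex a b} (p : (cmGraph a b).Walk u v),
      Odd p.length ↔ col u ≠ col v := by
    intro u v p
    induction p with
    | nil => simp
    | @cons u w v huw p ih =>
      have hne : col u ≠ col w := by
        rcases ((SimpleGraph.fromRel_adj _ _ _).1 huw).2 with h | h
        · exact hcol _ _ h
        · exact (hcol _ _ h).symm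
      rw [SimpleGraph.Walk.length_cons, Nat.odd_add_one, ih]
      revert hne
      generalize col u = x
      generalize col v = y
      generalize col w = z
      revert x y z
      decide
  have reach : ∀ u v : CMVertex a b, Relation.EqvGen (fun u v => OrientedEdge a b u v) u v →
      (cmGraph a b).Reachable u v := by
    intro u v huv
    induction huv with
    | rel x y hxy =>
      refine SimpleGraph.Adj.reachable ((SimpleGraph.fromRel_adj _ _ _).2 ⟨?_, .inl hxy⟩)
      rintro rfl
      exact hcol _ _ hxy rfl
    | refl x => exact .refl x
    | symm x y _ ih => exact ih.symm
    | trans x y z _ _ ih ih' => exact ih.trans ih'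
  constructor
  · rintro ⟨p, -, hp⟩
    exact (walk p).1 hp
  · intro hne
    obtain ⟨p⟩ := reach u v ((isComponentMeander a b).core.connected u v h)
    exact ⟨p.toPath, p.toPath.2, (walk _).2 hne⟩

open Classical in
/-- In `F̄^a` the coordinates of the intervals at odd distance from the base vertex are reversed.
After reversing them back, `F̄^a` becomes `F̄`, since every edge joins vertices at distances of
different parity. -/
theorem barAnti_eq (base : Fin (homotopyType a b).length → CMVertex a b)
    (hbase : ∀ i : Fin (homotopyType a b).length, base i ∈ pathVertices a b i) :
    barAnti F base = (coordDual F).comp (seaweedEquiv a b fun v =>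
      if OddPath a b (base (component v)) v then Fin.revPerm else Equiv.refl _).toLinearMap := by
  obtain ⟨col, hcol⟩ := (isComponentMeander a b).core.colouring
  have hodd : ∀ v, OddPath a b (base (component v)) v ↔ col (base (component v)) ≠ col v :=
    fun v => oddPath_iff hcol (Finset.mem_filter.1 (hbase (component v))).2
  have hedge : ∀ u v, OrientedEdge a b u v →
      (OddPath a b (base (component u)) u ↔ ¬OddPath a b (base (component v)) v) := by
    intro u v huv
    have hc : component u = component v :=
      Fin.ext ((isComponentMeander a b).core.label_edge u v huv)
    have hne : col u ≠ col v := hcol u v huv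
    rw [hodd, hodd, hc]
    revert hne
    generalize col (base (component v)) = x
    generalize col u = y
    generalize col v = z
    revert x y z
    decide
  ext X
  refine Eq.trans ?_ (coordDual_seaweedEquiv F _ (fun v s =>
    if OddPath a b (base (component v)) v then size a b v - 1 - s else s) (fun v s => ?_) X).symm
  · change (∑ i, barAntiComponent F (base i) i) X.1 = _
    rw [LinearMap.sum_apply]
    simp only [barAntiComponent, LinearMap.add_apply, LinearMap.sum_apply, Finset.sum_add_distrib]
    congr 1
    · rw [sum_pathVertices fun i v => (if OddPath a b (base i) v then
        shift (rotate (F i)) n (offset a b v) else shift (F i) n (offset a b v)) X.1]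
      refine Finset.sum_congr rfl fun v _ => ?_
      by_cases hv : OddPath a b (base (component v)) v
      · simp only [if_pos hv]
        rw [shift_rotate_apply]
        refine Finset.sum_congr rfl fun p _ => Finset.sum_congr rfl fun q _ => ?_
        have e : ∀ p : Fin ((homotopyType a b).get (component v)),
            (p.rev : ℕ) + offset a b v = offset a b v + (size a b v - 1 - p) := by
          intro p
          rw [Fin.val_rev, ← get_component]
          omega
        rw [e, e]
      · simp only [if_neg hv]
        rw [shift_apply]
        simp only [add_comm]
    · rw [sum_peakSet fun i u v => ∑ s ∈ Finset.range ((homotopyType a b).get i),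
        entryDual n (offset a b u + ((homotopyType a b).get i - 1 - s)) (offset a b v + s) X.1]
      refine Finset.sum_congr rfl fun u _ => Finset.sum_congr rfl fun v _ => ?_
      by_cases huv : OrientedEdge a b u v
      · rw [if_pos huv, if_pos huv, get_component]
        have hs : size a b u = size a b v := congrArg (fun i => (homotopyType a b).getD i 0)
          ((isComponentMeander a b).core.label_edge u v huv)
        by_cases hu : OddPath a b (base (component u)) u
        · have hv := (hedge u v huv).1 hu
          simp only [if_pos hu, if_neg hv]
        · have hv := not_not.1 (mt (hedge u v huv).2 hu)
          simp only [if_neg hu, if_pos hv]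
          rw [← Finset.sum_range_reflect]
          refine Finset.sum_congr rfl fun s hs' => ?_
          rw [Finset.mem_range] at hs'
          congr 2
          · omega
          · omega
      · rw [if_neg huv, if_neg huv]
  · split_ifs
    · rw [Fin.revPerm_apply, Fin.val_rev]
      omega
    · rfl

/-! ### Regular functionals -/

theorem sum_lieIndex_le (hlab : ∀ i < (homotopyType a b).length,
    ∃ v, (componentMeander a b).label.get v = i) :
    ∑ i, lieIndex (gl ((homotopyType a b).get i)) ≤ lieIndex (seaweed a b) := by
  obtain ⟨f, hf⟩ := exists_kernelDim_eq_lieIndex (seaweed a b)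
  let e := seaweedEquiv a b fun _ => Equiv.refl _
  have h : _ ≤ kernelDim (f.comp e.symm.toLinearMap) :=
    (isComponentMeander a b).core.le_kernelDim hlab
      (fun i => lieIndex (gl ((homotopyType a b).getD i 0))) (fun i _ => lieIndex_gl_le _) _
  have hcomp : (f.comp e.symm.toLinearMap).comp e.toLinearMap = f := by
    ext X
    exact congrArg f (e.symm_apply_apply X)
  rw [← kernelDim_comp e (seaweedEquiv_lie a b fun _ => Equiv.refl _), hcomp, hf,
    ← Fin.sum_univ_eq_sum_range (fun i => lieIndex (gl ((homotopyType a b).getD i 0)))] at h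
  refine le_of_eq_of_le (Finset.sum_congr rfl fun i _ => ?_) h
  exact congrArg (fun c => lieIndex (gl c)) (by simp)

/-- The kernel dimension of the functional is the sum of the `dim ker B_{F_{c_i}}`, and its least
value is the sum of the least values. -/
theorem isRegular_iff (hlab : ∀ i < (homotopyType a b).length,
    ∃ v, (componentMeander a b).label.get v = i) (σ : ∀ v, Equiv.Perm (Fin (size a b v))) :
    IsRegular ((coordDual F).comp (seaweedEquiv a b σ).toLinearMap) ↔ ∀ i, IsRegular (F i) := by
  have hdim : ∀ F : ComponentFunctionals a b,
      kernelDim ((coordDual F).comp (seaweedEquiv a b σ).toLinearMap) = ∑ i, kernelDim (F i) :=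
    fun F => (kernelDim_comp _ (seaweedEquiv_lie a b σ) _).trans (kernelDim_coordDual F)
  choose F₀ hF₀ using fun i : Fin (homotopyType a b).length =>
    exists_kernelDim_eq_lieIndex (gl ((homotopyType a b).get i))
  have hindex : lieIndex (seaweed a b) = ∑ i, lieIndex (gl ((homotopyType a b).get i)) := by
    refine le_antisymm ?_ (sum_lieIndex_le hlab)
    rw [← Finset.sum_congr rfl fun i _ => hF₀ i, ← hdim]
    exact lieIndex_le _
  rw [IsRegular, hdim, hindex, eq_comm,
    Finset.sum_eq_sum_iff_of_le fun i _ => lieIndex_le (F i)]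
  exact forall_congr' fun i => ⟨fun h => (h (Finset.mem_univ i)).symm, fun h _ => h.symm⟩

end Seaweed

theorem mainTheorem2 {n : ℕ} (a b : Composition n) (F : Seaweed.ComponentFunctionals a b)
    (base : Fin (Seaweed.homotopyType a b).length → Seaweed.CMVertex a b)
    (hbase : ∀ i : Fin (Seaweed.homotopyType a b).length, base i ∈ Seaweed.pathVertices a b i) :
    (Seaweed.IsRegular (Seaweed.bar F) ↔ ∀ i, Seaweed.IsRegular (F i)) ∧
    (Seaweed.IsRegular (Seaweed.barAnti F base) ↔ ∀ i, Seaweed.IsRegular (F i)) := by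
  have hlab : ∀ i < (Seaweed.homotopyType a b).length,
      ∃ v, (Seaweed.componentMeander a b).label.get v = i :=
    fun i hi => ⟨base ⟨i, hi⟩, (Finset.mem_filter.1 (hbase ⟨i, hi⟩)).2⟩
  rw [Seaweed.bar_eq, Seaweed.barAnti_eq F base hbase]
  exact ⟨Seaweed.isRegular_iff F hlab _, Seaweed.isRegular_iff F hlab _⟩
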